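/- **Theorem 3.4.** Let $F$ be a field with $\operatorname{char} F \neq 2$, let $n \ge 1$ be an integer, and let $\lambda$ be a partition of $n$. Write $\Sigma_k$ for the symmetric group on $\{1,\dots,k\}$, with $\Sigma_{k}\subset\Sigma_{k+1}$ as the stabilizer of $k+1$. Let $S^\lambda$ be the Specht module of $\lambda$ over $F$, that is, the $F\Sigma_n$-submodule of the permutation module $M^\lambda$ on the $\lambda$-tabloids spanned by the polytabloids $e_t=\sum_{\pi\in C_t}\operatorname{sgn}(\pi)\{t\pi\}$, where $t$ runs over all $\lambda$-tableaux (bijections from the nodes of the Young diagram of $\lambda$ to $\{1,\dots,n\}$), $\{t\}$ is the tabloid of $t$ (the ordered partition of $\{1,\dots,n\}$ whose parts are the sets of entries of the rows of $t$), $C_t$ is the column stabilizer of $t$, and permutations act on the right. A block idempotent of a group algebra is a primitive idempotent of its centre, and a module is indecomposable if it is nonzero and is not the direct sum of two nonzero submodules. 1. For every block idempotent $b$ of $F\Sigma_{n-1}$, the $F\Sigma_{n-1}$-module $(S^\lambda{\downarrow}_{\Sigma_{n-1}})\,b$ is $0$ or indecomposable. 2. For every block idempotent $B$ of $F\Sigma_{n+1}$,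 the $F\Sigma_{n+1}$-module $(S^\lambda{\uparrow}^{\Sigma_{n+1}})\,B$ is $0$ or indecomposable. -/

import Mathlib

noncomputable section

namespace SpechtModules

open Equiv

/-! ### Tableaux, tabloids and polytabloids

Partitions of `n` are given by their Young diagrams `μ` with `n` cells; the node `(i, j)` lies in
row `i` and column `j`, both counted from `0`.  The set `{1, …, n}` is modelled by `Fin n`, and
permutations act on the left. -/

/-- A `μ`-tableau: a bijection from the nodes of `μ` to an `n`-element set of entries. -/
abbrev Tableau (μ : YoungDiagram) (n : ℕ) : Type := μ.cells ≃ Fin n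

/-- A `μ`-tabloid: an ordered partition of the set of entries into parts `P₀, P₁, …` whose sizes
are the row lengths of `μ`.  `idx x = i` means that `x` belongs to `Pᵢ`. -/
@[ext]
structure Tabloid (μ : YoungDiagram) (n : ℕ) : Type where
  idx : Fin n → ℕ
  card_part : ∀ i, (Finset.univ.filter fun x => idx x = i).card = μ.rowLen i

variable {μ : YoungDiagram} {n : ℕ}

/-- The symmetric group permutes the tabloids: the `i`-th part of `σ • T` is the image under `σ`
of the `i`-th part of `T`. -/
instance : MulAction (Perm (Fin n)) (Tabloid μ n) where
  smul σ T :=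
    { idx := fun x => T.idx (σ⁻¹ x)
      card_part := fun i => by
        rw [← T.card_part i]
        refine Finset.card_bij (fun x _ => σ⁻¹ x) (by simp) (by simp) ?_
        intro y hy
        exact ⟨σ y, by simpa using hy, by simp⟩ }
  one_smul _ := by ext; rfl
  mul_smul _ _ _ := by ext; rfl

/-- The tabloid `{t}` of a tableau `t`: its `i`-th part is the set of entries of row `i` of `t`. -/
def Tableau.tabloid (t : Tableau μ n) : Tabloid μ n where
  idx x := (t.symm x).1.1
  card_part i := by
    rw [YoungDiagram.rowLen_eq_card]
    refine Finset.card_bij (fun x _ => (t.symm x).1) ?_ ?_ ?_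
    · intro x hx
      rw [YoungDiagram.mem_row_iff]
      exact ⟨(t.symm x).2, by simpa using hx⟩
    · intro x _ y _ h
      exact t.symm.injective (Subtype.ext h)
    · intro c hc
      rw [YoungDiagram.mem_row_iff] at hc
      exact ⟨t ⟨c, hc.1⟩, by simpa using hc.2, by simp⟩

/-- The column stabilizer `C_t`: the permutations that send every entry of `t` to an entry of the
same column. -/
def Tableau.columnStabilizer (t : Tableau μ n) : Subgroup (Perm (Fin n)) where
  carrier := {π | ∀ x, (t.symm (π x)).1.2 = (t.symm x).1.2}
  mul_mem' ha hb x := by rw [Perm.mul_apply, ha, hb]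
  one_mem' _ := rfl
  inv_mem' {a} ha x := by
    have h := ha (a⁻¹ x)
    have h' : a (a⁻¹ x) = x := a.apply_symm_apply x
    rw [h'] at h
    exact h.symm

variable (F : Type*) [Field F]

/-- The permutation module `M^μ` on the formal `F`-linear combinations of `μ`-tabloids. -/
abbrev permutationRep (μ : YoungDiagram) (n : ℕ) :
    Representation F (Perm (Fin n)) (MonoidAlgebra F (Tabloid μ n)) :=
  Representation.ofMulAction F (Perm (Fin n)) (Tabloid μ n)

open scoped Classical in
/-- The polytabloid `e_t = ∑_{π ∈ C_t} sgn(π) {πt}`; the tableau `πt` is `t` followed by `π`. -/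
def polytabloid (t : Tableau μ n) : MonoidAlgebra F (Tabloid μ n) :=
  ∑ π ∈ Finset.univ.filter (fun π : Perm (Fin n) => π ∈ t.columnStabilizer),
    MonoidAlgebra.single (Tableau.tabloid (t.trans π)) (((Perm.sign π : ℤˣ) : ℤ) : F)

theorem permutationRep_polytabloid (σ : Perm (Fin n)) (t : Tableau μ n) :
    permutationRep F μ n σ (polytabloid F t) = polytabloid F (t.trans σ) := by
  classical
  unfold polytabloid
  rw [map_sum]
  refine Finset.sum_bij (fun π _ => σ * π * σ⁻¹) ?_ ?_ ?_ ?_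
  · intro π hπ
    simp only [Finset.mem_filter, Finset.mem_univ, true_and] at hπ ⊢
    intro x
    have h := hπ (σ⁻¹ x)
    simpa [Perm.mul_apply] using h
  · intro a _ b _ h
    simpa using h
  · intro π hπ
    simp only [Finset.mem_filter, Finset.mem_univ, true_and] at hπ
    refine ⟨σ⁻¹ * π * σ, ?_, by simp [mul_assoc]⟩
    simp only [Finset.mem_filter, Finset.mem_univ, true_and]
    intro x
    have h := hπ (σ x)
    simpa [Perm.mul_apply] using h
  · intro π _
    rw [Representation.ofMulAction_single]
    congr 1
    · ext x
      change (t.symm (π.symm (σ⁻¹ x))).1.1 = (t.symm (σ.symm ((σ * π * σ⁻¹)⁻¹ x))).1.1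
      have h : π.symm (σ⁻¹ x) = σ.symm ((σ * π * σ⁻¹)⁻¹ x) := by
        simp [mul_inv_rev, Perm.mul_apply]
      rw [h]
    · have h : Perm.sign (σ * π * σ⁻¹) = Perm.sign π := by
        rw [Perm.sign_mul, Perm.sign_mul, Perm.sign_inv, mul_right_comm, Int.units_mul_self,
          one_mul]
      rw [h]

/-- The Specht module as a subrepresentation of `M^μ`: the `F`-span of all polytabloids. -/
def spechtSub (μ : YoungDiagram) (n : ℕ) : Subrepresentation (permutationRep F μ n) where
  toSubmodule := Submodule.span F (Set.range fun t : Tableau μ n => polytabloid F t)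
  apply_mem_toSubmodule σ v hv := by
    induction hv using Submodule.span_induction with
    | mem x hx =>
      obtain ⟨t, rfl⟩ := hx
      rw [permutationRep_polytabloid]
      exact Submodule.subset_span ⟨_, rfl⟩
    | zero => simp
    | add x y _ _ hx hy => rw [map_add]; exact Submodule.add_mem _ hx hy
    | smul a x _ hx => rw [map_smul]; exact Submodule.smul_mem _ a hx

/-- The underlying vector space of the Specht module `S^μ`. -/
def SpechtModule (μ : YoungDiagram) (n : ℕ) : Type _ := (spechtSub F μ n).toSubmodule

instance (μ : YoungDiagram) (n : ℕ) : AddCommGroup (SpechtModule F μ n) :=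
  inferInstanceAs (AddCommGroup (spechtSub F μ n).toSubmodule)

instance (μ : YoungDiagram) (n : ℕ) : Module F (SpechtModule F μ n) :=
  inferInstanceAs (Module F (spechtSub F μ n).toSubmodule)

/-- The Specht module `S^μ` as a representation of the symmetric group on `n` letters. -/
def spechtRep (μ : YoungDiagram) (n : ℕ) :
    Representation F (Perm (Fin n)) (SpechtModule F μ n) :=
  (spechtSub F μ n).toRepresentation

/-! ### Restriction and induction -/

/-- The usual embedding of the symmetric group on `n` letters into that on `n + 1` letters, as
the stabilizer of the last letter. -/
def symEmb (n : ℕ) : Perm (Fin n) →* Perm (Fin (n + 1)) :=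
  Perm.viaEmbeddingHom Fin.castSuccEmb

/-- The restriction of a representation from `n + 1` letters to `n` letters. -/
def restrictRep {V : Type*} [AddCommGroup V] [Module F V]
    (ρ : Representation F (Perm (Fin (n + 1))) V) : Representation F (Perm (Fin n)) V :=
  ρ.comp (symEmb n)

/-- The induction of a representation from `n` letters to `n + 1` letters. -/
def induceRep {V : Type*} [AddCommGroup V] [Module F V]
    (ρ : Representation F (Perm (Fin n)) V) :
    Representation F (Perm (Fin (n + 1))) (Representation.IndV (symEmb n) ρ) :=
  Representation.ind (symEmb n) ρ

/-! ### Block idempotents and indecomposable modules -/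

/-- A block idempotent of a ring `A`: a primitive idempotent of the centre of `A`, i.e. a nonzero
central idempotent that is not the sum of two orthogonal nonzero central idempotents. -/
structure IsBlockIdempotent {A : Type*} [Ring A] (b : A) : Prop where
  ne_zero : b ≠ 0
  mem_center : b ∈ Subring.center A
  idem : IsIdempotentElem b
  primitive : ∀ e f : A, e ∈ Subring.center A → f ∈ Subring.center A →
    IsIdempotentElem e → IsIdempotentElem f → e * f = 0 → e + f = b → e = 0 ∨ f = 0

/-- For a central element `b` of `A`, the submodule `bM = {b • m | m ∈ M}` of an `A`-module `M`. -/
def blockPart {A : Type*} [Ring A] (b : A) (hb : b ∈ Subring.center A)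
    (M : Type*) [AddCommGroup M] [Module A M] : Submodule A M where
  carrier := {x | ∃ m : M, b • m = x}
  zero_mem' := ⟨0, smul_zero b⟩
  add_mem' := by
    rintro _ _ ⟨m, rfl⟩ ⟨m', rfl⟩
    exact ⟨m + m', smul_add b m m'⟩
  smul_mem' := by
    rintro a _ ⟨m, rfl⟩
    exact ⟨a • m, by rw [smul_smul, smul_smul, Subring.mem_center_iff.1 hb a]⟩

/-- A module is indecomposable if it is nonzero and is not the internal direct sum of two nonzero
submodules. -/
def IsIndecomposableModule (A M : Type*) [Ring A] [AddCommGroup M] [Module A M] : Prop :=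
  Nontrivial M ∧ ∀ N N' : Submodule A M, IsCompl N N' → N = ⊥ ∨ N' = ⊥

end SpechtModules

end

noncomputable section

namespace SpechtModules

open Equiv

/-! ### Coefficients of polytabloids as functions of row assignments. -/

section Coefficients

variable {μ : YoungDiagram} {n : ℕ}

/-! Both halves are statements about endomorphism rings. Suppose that every endomorphism of a module
is the action of a central element of the group algebra. A decomposition of the `b`-component then
gives a projection that acts as `b * z` with `z` central. Since `b` is primitive, `b * z` is
nilpotent or invertible in the ideal of `b` (`IsBlockIdempotent.nilpotent_or_invertible`), so one of
the two summands vanishes.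

Restriction: let L be the sum of the transpositions that move the last letter l. Every endomorphism
of the restricted Specht module is a polynomial in L (`exists_eq_aeval_jucysMurphy`). The full
Specht module has only scalar endomorphisms (`exists_eq_smul_of_commute`), so the sum of all
transpositions acts as a scalar, and L acts as a scalar minus the sum of the transpositions of the
smaller group, which is central there.

To see that L generates, filter the Specht module by the length of the column that contains l. On
each layer L acts as a scalar modulo shorter columns, so a monic q with one linear factor per
shorter layer makes q(L) kill those layers. On the next layer q(L) is nonzero, because an explicit
coefficient equals 1 (`spechtCoeff_aeval_cornerCycle`). Conversely, a map that commutes with the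
stabilizer of l and kills the shorter layers is determined on the next one by a single coefficient
(`spechtCoeff_shiftedRow_ne_zero`), so it agrees there with a multiple of q(L). Induction over the
layers finishes this; the scalars need not be distinct in F.

Induction: there are two double cosets, so an endomorphism is determined by a component at the
identity, which is a scalar, and a component at one transposition, which is an endomorphism of the
restriction and hence a polynomial in L. A recurrence shows that polynomials in the class sum of
transpositions realize all such pairs (`exists_eq_aeval_swapSum_of_commute_ind`).

All coefficient arguments treat a vector as a function of maps T from entries to rows, on which
permutations act by composition. -/

/-- The row of the entry `x` of the tableau `t`. -/
def Tableau.row (t : Tableau μ n) (x : Fin n) : ℕ := (t.symm x).1.1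

/-- The column of the entry `x` of the tableau `t`. -/
def Tableau.col (t : Tableau μ n) (x : Fin n) : ℕ := (t.symm x).1.2

theorem Tableau.row_trans (t : Tableau μ n) (σ : Perm (Fin n)) (x : Fin n) :
    Tableau.row (t.trans σ) x = t.row (σ⁻¹ x) := rfl

theorem Tableau.col_trans (t : Tableau μ n) (σ : Perm (Fin n)) (x : Fin n) :
    Tableau.col (t.trans σ) x = t.col (σ⁻¹ x) := rfl

theorem Tableau.mem_diagram (t : Tableau μ n) (x : Fin n) : (t.row x, t.col x) ∈ μ :=
  (t.symm x).2

theorem Tableau.row_lt_colLen (t : Tableau μ n) (x : Fin n) : t.row x < μ.colLen (t.col x) :=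
  YoungDiagram.mem_iff_lt_colLen.1 (t.mem_diagram x)

theorem Tableau.col_lt_rowLen (t : Tableau μ n) (x : Fin n) : t.col x < μ.rowLen (t.row x) :=
  YoungDiagram.mem_iff_lt_rowLen.1 (t.mem_diagram x)

theorem Tableau.ext_row_col (t : Tableau μ n) {x y : Fin n} (hr : t.row x = t.row y)
    (hc : t.col x = t.col y) : x = y :=
  t.symm.injective (Subtype.ext (Prod.ext hr hc))

theorem Tableau.exists_entry (t : Tableau μ n) {i j : ℕ} (h : (i, j) ∈ μ) :
    ∃ x, t.row x = i ∧ t.col x = j :=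
  ⟨t ⟨(i, j), h⟩, by simp [Tableau.row], by simp [Tableau.col]⟩

theorem Tableau.card_row_filter (t : Tableau μ n) (i : ℕ) :
    (Finset.univ.filter fun x => t.row x = i).card = μ.rowLen i :=
  t.tabloid.card_part i

theorem Tableau.card_col_filter (t : Tableau μ n) (j : ℕ) :
    (Finset.univ.filter fun x => t.col x = j).card = μ.colLen j := by
  rw [YoungDiagram.colLen_eq_card]
  refine Finset.card_bij (fun x _ => (t.symm x).1) ?_ ?_ ?_
  · intro x hx
    rw [YoungDiagram.mem_col_iff]
    exact ⟨(t.symm x).2, (Finset.mem_filter.1 hx).2⟩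
  · intro x _ y _ h
    exact t.symm.injective (Subtype.ext h)
  · intro c hc
    rw [YoungDiagram.mem_col_iff] at hc
    exact ⟨t ⟨c, hc.1⟩, Finset.mem_filter.2 ⟨Finset.mem_univ _, by
      simpa [Tableau.col] using hc.2⟩, by simp⟩

variable (F : Type*) [Field F]

open scoped Classical in
/-- The coefficients of an element of `M^μ`, as a function on all maps that assign a row to each
entry; the coefficient is zero on maps that do not describe a `μ`-tabloid. -/
def tabloidCoeff : MonoidAlgebra F (Tabloid μ n) →ₗ[F] ((Fin n → ℕ) → F) where
  toFun m T :=
    if h : ∀ i, (Finset.univ.filter fun x => T x = i).card = μ.rowLen i then m.coeff ⟨T, h⟩ else 0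
  map_add' a b := by
    ext T
    simp only [Pi.add_apply]
    split_ifs <;> simp
  map_smul' a b := by
    ext T
    simp only [Pi.smul_apply, RingHom.id_apply]
    split_ifs <;> simp

variable {F}

theorem tabloidCoeff_idx (m : MonoidAlgebra F (Tabloid μ n)) (T : Tabloid μ n) :
    tabloidCoeff F m T.idx = m.coeff T := by
  classical
  change dite _ _ _ = _
  rw [dif_pos T.card_part]

theorem tabloidCoeff_injective :
    Function.Injective (tabloidCoeff F : MonoidAlgebra F (Tabloid μ n) →ₗ[F] _) := by
  intro a b h
  ext T
  rw [← tabloidCoeff_idx, h, tabloidCoeff_idx]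

theorem card_fiber_of_tabloidCoeff_ne_zero {m : MonoidAlgebra F (Tabloid μ n)} {T : Fin n → ℕ}
    (h : tabloidCoeff F m T ≠ 0) (i : ℕ) :
    (Finset.univ.filter fun x => T x = i).card = μ.rowLen i := by
  classical
  by_contra hi
  apply h
  change dite _ _ _ = _
  rw [dif_neg fun h' => hi (h' i)]

theorem card_fiber_comp (T : Fin n → ℕ) (σ : Perm (Fin n)) (i : ℕ) :
    (Finset.univ.filter fun x => (T ∘ σ) x = i).card =
      (Finset.univ.filter fun x => T x = i).card := by
  refine Finset.card_bij (fun x _ => σ x) (by simp) (by simp) ?_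
  intro y hy
  exact ⟨σ⁻¹ y, by simpa using hy, by simp⟩

theorem tabloidCoeff_permutationRep (m : MonoidAlgebra F (Tabloid μ n)) (σ : Perm (Fin n))
    (T : Fin n → ℕ) :
    tabloidCoeff F (permutationRep F μ n σ m) T = tabloidCoeff F m (T ∘ σ) := by
  classical
  by_cases h : ∀ i, (Finset.univ.filter fun x => T x = i).card = μ.rowLen i
  · have h' : ∀ i, (Finset.univ.filter fun x => (T ∘ σ) x = i).card = μ.rowLen i := fun i => by
      rw [card_fiber_comp, h i]
    change dite _ _ _ = dite _ _ _
    rw [dif_pos h, dif_pos h', Representation.coeff_ofMulAction]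
    rfl
  · have h' : ¬ ∀ i, (Finset.univ.filter fun x => (T ∘ σ) x = i).card = μ.rowLen i := fun h' => by
      apply h
      intro i
      rw [← card_fiber_comp T σ, h' i]
    change dite _ _ _ = dite _ _ _
    rw [dif_neg h, dif_neg h']

open scoped Classical in
theorem tabloidCoeff_single (T : Tabloid μ n) (a : F) (T' : Fin n → ℕ) :
    tabloidCoeff F (MonoidAlgebra.single T a) T' = if T.idx = T' then a else 0 := by
  change dite _ _ _ = _
  split_ifs with h h' h'
  · subst h'
    simp
  · rw [MonoidAlgebra.coeff_single, Finsupp.single_eq_of_ne]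
    rintro rfl
    exact h' rfl
  · subst h'
    exact absurd T.card_part h
  · rfl

open scoped Classical in
theorem tabloidCoeff_polytabloid (t : Tableau μ n) (T : Fin n → ℕ) :
    tabloidCoeff F (polytabloid F t) T =
      ∑ π ∈ Finset.univ.filter (fun π : Perm (Fin n) => π ∈ t.columnStabilizer),
        if t.row ∘ ⇑π⁻¹ = T then (((Perm.sign π : ℤˣ) : ℤ) : F) else 0 := by
  unfold polytabloid
  rw [map_sum, Finset.sum_apply]
  refine Finset.sum_congr rfl fun π _ => ?_
  rw [tabloidCoeff_single]
  rfl

/-- Left multiplication by `σ` permutes the column stabilizer and multiplies every sign by that of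
`σ`. -/
theorem tabloidCoeff_polytabloid_comp (t : Tableau μ n) {σ : Perm (Fin n)}
    (hσ : σ ∈ t.columnStabilizer) (T : Fin n → ℕ) :
    tabloidCoeff F (polytabloid F t) (T ∘ σ) =
      (((Perm.sign σ : ℤˣ) : ℤ) : F) * tabloidCoeff F (polytabloid F t) T := by
  classical
  rw [tabloidCoeff_polytabloid, tabloidCoeff_polytabloid, Finset.mul_sum]
  refine Finset.sum_bij (fun π _ => σ * π) ?_ ?_ ?_ ?_
  · intro π hπ
    simp only [Finset.mem_filter, Finset.mem_univ, true_and] at hπ ⊢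
    exact mul_mem hσ hπ
  · intro a _ b _ h
    simpa using h
  · intro π hπ
    simp only [Finset.mem_filter, Finset.mem_univ, true_and] at hπ
    exact ⟨σ⁻¹ * π, by simpa using mul_mem (inv_mem hσ) hπ, by simp⟩
  · intro π _
    have key : t.row ∘ ⇑π⁻¹ = T ∘ ⇑σ ↔ t.row ∘ ⇑(σ * π)⁻¹ = T := by
      constructor
      · intro h
        ext x
        have := congrFun h (σ⁻¹ x)
        simpa [mul_inv_rev] using this
      · intro h
        ext x
        have := congrFun h (σ x)
        simpa [mul_inv_rev] using this
    simp only [key]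
    split_ifs
    · rw [Perm.sign_mul, ← Int.cast_mul, ← Units.val_mul, ← mul_assoc, Int.units_mul_self, one_mul]
    · rw [mul_zero]

theorem Tableau.swap_mem_columnStabilizer (t : Tableau μ n) {x y : Fin n}
    (h : t.col x = t.col y) : swap x y ∈ t.columnStabilizer := by
  intro z
  change t.col _ = t.col z
  rcases eq_or_ne z x with rfl | hx
  · rw [swap_apply_left, h]
  rcases eq_or_ne z y with rfl | hy
  · rw [swap_apply_right, h]
  rw [swap_apply_of_ne_of_ne hx hy]

theorem tabloidCoeff_polytabloid_swap (t : Tableau μ n) {x y : Fin n} (hxy : x ≠ y)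
    (h : t.col x = t.col y) (T : Fin n → ℕ) :
    tabloidCoeff F (polytabloid F t) (T ∘ swap x y) = - tabloidCoeff F (polytabloid F t) T := by
  rw [tabloidCoeff_polytabloid_comp t (t.swap_mem_columnStabilizer h), Perm.sign_swap hxy]
  simp

/-- On the support, `T` is the row function of `t` followed by a column-preserving permutation, so
each entry takes the row of some entry in its own column. -/
theorem lt_colLen_of_tabloidCoeff_polytabloid_ne_zero {t : Tableau μ n} {T : Fin n → ℕ}
    (h : tabloidCoeff F (polytabloid F t) T ≠ 0) (x : Fin n) : T x < μ.colLen (t.col x) := by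
  classical
  rw [tabloidCoeff_polytabloid] at h
  obtain ⟨π, hπ, hne⟩ := Finset.exists_ne_zero_of_sum_ne_zero h
  simp only [Finset.mem_filter, Finset.mem_univ, true_and] at hπ
  have hT : t.row ∘ ⇑π⁻¹ = T := by
    by_contra h'
    rw [if_neg h'] at hne
    exact hne rfl
  rw [← hT]
  have hc : t.col (π⁻¹ x) = t.col x := inv_mem hπ x
  rw [← hc]
  exact t.row_lt_colLen _

/-- A permutation that preserves both the rows and the columns of `t` is trivial, so only one term
survives. -/
theorem tabloidCoeff_polytabloid_row (t : Tableau μ n) :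
    tabloidCoeff F (polytabloid F t) t.row = 1 := by
  classical
  rw [tabloidCoeff_polytabloid, Finset.sum_eq_single 1]
  · simp
  · intro π hπ hne
    simp only [Finset.mem_filter, Finset.mem_univ, true_and] at hπ
    rw [if_neg]
    intro h
    apply hne
    rw [← inv_eq_one]
    ext x : 1
    exact t.ext_row_col (congrFun h x) (inv_mem hπ x)
  · intro h
    exact absurd (by simp [one_mem]) h

end Coefficients

/-! ### Garnir-type exchange relations and the kernel relations. -/

section Exchange

variable {μ : YoungDiagram} {n : ℕ} {F : Type*} [Field F]

theorem comp_swap_of_eq {X : Type*} [DecidableEq X] (T : X → ℕ) {p q : X} (h : T p = T q) :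
    T ∘ swap p q = T := by
  ext z
  rw [Function.comp_apply, swap_apply_def]
  split_ifs with h1 h2
  · rw [h1, h]
  · rw [h2, h]
  · rfl

theorem swap_mul_swap_eq {X : Type*} [DecidableEq X] {y q z : X} (hqy : q ≠ y) (hqz : q ≠ z) :
    swap y q * swap y z = swap y z * swap z q := by
  have h := swap_apply_apply (swap y z) y q
  rw [swap_apply_left, swap_apply_of_ne_of_ne hqy hqz] at h
  rw [h, swap_inv, ← mul_assoc, ← mul_assoc, swap_mul_self, one_mul]

/-- This is how characteristic two is excluded in the coefficient arguments: an antisymmetric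
function vanishes where two entries of a column share a value. -/
theorem eq_zero_of_eq_neg_self (h2 : (2 : F) ≠ 0) {a : F} (h : a = -a) : a = 0 := by
  have h3 : 2 * a = 0 := by linear_combination h
  exact (mul_eq_zero.1 h3).resolve_left h2

/-- The difference `H` of the two sides is antisymmetric in `y` together with column `c`, which is
one entry more than `colLen c`. Where `H` is nonzero, all values on these entries are below `colLen
c`, so two coincide, and antisymmetry forces `H` to vanish after all. -/
theorem tabloidCoeff_polytabloid_exchange (h2 : (2 : F) ≠ 0) (t : Tableau μ n) {c : ℕ}
    {y : Fin n} (hc : c ≠ t.col y) (hlen : μ.colLen (t.col y) ≤ μ.colLen c) (T : Fin n → ℕ) :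
    tabloidCoeff F (polytabloid F t) T =
      ∑ z ∈ Finset.univ.filter (fun z => t.col z = c),
        tabloidCoeff F (polytabloid F t) (T ∘ swap y z) := by
  set e := tabloidCoeff F (polytabloid F t) with he
  have hA : ∀ {p q : Fin n}, p ≠ q → t.col p = t.col q → ∀ T, e (T ∘ swap p q) = - e T :=
    fun hpq h T => tabloidCoeff_polytabloid_swap t hpq h T
  set C := Finset.univ.filter (fun z => t.col z = c) with hC
  have hyC : y ∉ C := by simp [hC, hc.symm]
  let H : (Fin n → ℕ) → F := fun T => e T - ∑ z ∈ C, e (T ∘ swap y z)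
  have hHy : ∀ q ∈ C, ∀ T, H (T ∘ swap y q) = - H T := by
    intro q hq T
    have hqc : t.col q = c := by simpa [hC] using hq
    change e _ - _ = - (e T - _)
    rw [← Finset.add_sum_erase _ _ hq, ← Finset.add_sum_erase C _ hq]
    have h1 : (T ∘ swap y q) ∘ swap y q = T := by
      ext z; simp
    have h3 : ∑ z ∈ C.erase q, e ((T ∘ swap y q) ∘ swap y z) =
        - ∑ z ∈ C.erase q, e (T ∘ swap y z) := by
      rw [← Finset.sum_neg_distrib]
      refine Finset.sum_congr rfl fun z hz => ?_
      rw [Finset.mem_erase] at hz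
      have hzc : t.col z = c := by simpa [hC] using hz.2
      have hqy : q ≠ y := fun h => hyC (h ▸ hq)
      rw [← hA hz.1 (hzc.trans hqc.symm), Function.comp_assoc, Function.comp_assoc,
        ← Perm.coe_mul, ← Perm.coe_mul, swap_mul_swap_eq hqy hz.1.symm]
    rw [h1, h3]
    ring
  have hHC : ∀ p ∈ C, ∀ q ∈ C, p ≠ q → ∀ T, H (T ∘ swap p q) = - H T := by
    intro p hp q hq hpq T
    have hpc : t.col p = c := by simpa [hC] using hp
    have hqc : t.col q = c := by simpa [hC] using hq
    have hpy : p ≠ y := fun h => hyC (h ▸ hp)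
    have hqy : q ≠ y := fun h => hyC (h ▸ hq)
    have h3 : ∑ z ∈ C, e ((T ∘ swap p q) ∘ swap y z) = - ∑ z ∈ C, e (T ∘ swap y z) := by
      rw [← Finset.sum_neg_distrib]
      refine Finset.sum_bij (fun z _ => swap p q z) ?_ ?_ ?_ ?_
      · intro z hz
        rw [swap_apply_def]
        split_ifs <;> assumption
      · intro a _ b _ h
        simpa using h
      · intro z hz
        refine ⟨swap p q z, ?_, by simp⟩
        rw [swap_apply_def]
        split_ifs <;> assumption
      · intro z hz
        rw [← hA hpq (hpc.trans hqc.symm)]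
        congr 1
        rw [Function.comp_assoc, Function.comp_assoc, ← Perm.coe_mul, ← Perm.coe_mul]
        congr 2
        have : swap y (swap p q z) = swap p q * swap y z * (swap p q)⁻¹ := by
          rw [← swap_apply_apply, swap_apply_of_ne_of_ne hpy.symm hqy.symm]
        rw [this]
        simp [mul_assoc]
    change e _ - _ = - (e T - _)
    rw [h3, hA hpq (hpc.trans hqc.symm)]
    ring
  have hH : H T = 0 := by
    by_contra hne
    have hval : ∀ w ∈ insert y C, T w < μ.colLen c := by
      have hCc : ∀ w ∈ C, t.col w = c := fun w hw => by simpa [hC] using hw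
      by_cases h0 : e T = 0
      · have hs : ∑ z ∈ C, e (T ∘ swap y z) ≠ 0 := by
          intro hs
          exact hne (by change e T - _ = 0; rw [h0, hs, sub_zero])
        obtain ⟨z, hz, hz0⟩ := Finset.exists_ne_zero_of_sum_ne_zero hs
        have hv := lt_colLen_of_tabloidCoeff_polytabloid_ne_zero hz0
        intro w hw
        have h1 := hv (swap y z w)
        simp only [Function.comp_apply, swap_apply_self] at h1
        refine h1.trans_le ?_
        rcases eq_or_ne w y with rfl | hwy
        · rw [swap_apply_left, hCc z hz]
        rcases eq_or_ne w z with rfl | hwz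
        · rw [swap_apply_right]; exact hlen
        · rw [swap_apply_of_ne_of_ne hwy hwz, hCc w (Finset.mem_of_mem_insert_of_ne hw hwy)]
      · intro w hw
        refine (lt_colLen_of_tabloidCoeff_polytabloid_ne_zero h0 w).trans_le ?_
        rcases Finset.mem_insert.1 hw with rfl | hw
        · exact hlen
        · rw [hCc w hw]
    obtain ⟨p, hp, q, hq, hpq, hT⟩ :=
      Finset.exists_ne_map_eq_of_card_lt_of_maps_to (s := insert y C)
        (t := Finset.range (μ.colLen c)) (f := T)
        (by rw [Finset.card_insert_of_notMem hyC, Finset.card_range, hC, t.card_col_filter]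
            exact Nat.lt_succ_self _)
        (fun w hw => by simpa using hval w hw)
    apply hne
    apply eq_zero_of_eq_neg_self h2
    conv_lhs => rw [← comp_swap_of_eq T hT]
    rcases Finset.mem_insert.1 hp with hp' | hp'
    · rcases Finset.mem_insert.1 hq with hq' | hq'
      · exact absurd (hp'.trans hq'.symm) hpq
      · rw [hp']
        exact hHy q hq' T
    · rcases Finset.mem_insert.1 hq with hq' | hq'
      · rw [hq', swap_comm]
        exact hHy p hp' T
      · exact hHC p hp' q hq' hpq T
  exact sub_eq_zero.1 hH

theorem eq_of_col_eq_of_tabloidCoeff_polytabloid_ne_zero (h2 : (2 : F) ≠ 0) {t : Tableau μ n}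
    {T : Fin n → ℕ} (h : tabloidCoeff F (polytabloid F t) T ≠ 0) {x y : Fin n}
    (hc : t.col x = t.col y) (hT : T x = T y) : x = y := by
  by_contra hxy
  apply h
  apply eq_zero_of_eq_neg_self h2
  conv_lhs => rw [← comp_swap_of_eq T hT]
  exact tabloidCoeff_polytabloid_swap t hxy hc T

/-- On the support, `T` is injective on a column with values below its length, hence a bijection
onto these values. -/
theorem exists_of_tabloidCoeff_polytabloid_ne_zero (h2 : (2 : F) ≠ 0) {t : Tableau μ n}
    {T : Fin n → ℕ} (h : tabloidCoeff F (polytabloid F t) T ≠ 0) {c j : ℕ}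
    (hj : j < μ.colLen c) : ∃ q, t.col q = c ∧ T q = j := by
  have himg : (Finset.univ.filter fun x => t.col x = c).image T = Finset.range (μ.colLen c) := by
    apply Finset.eq_of_subset_of_card_le
    · intro a ha
      obtain ⟨x, hx, rfl⟩ := Finset.mem_image.1 ha
      have hx' : t.col x = c := by simpa using hx
      rw [Finset.mem_range, ← hx']
      exact lt_colLen_of_tabloidCoeff_polytabloid_ne_zero h x
    · rw [Finset.card_range, Finset.card_image_of_injOn, t.card_col_filter]
      intro x hx y hy hxy
      have hx' : t.col x = c := by simpa using hx
      have hy' : t.col y = c := by simpa using hy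
      exact eq_of_col_eq_of_tabloidCoeff_polytabloid_ne_zero h2 h (hx'.trans hy'.symm) hxy
  have : j ∈ (Finset.univ.filter fun x => t.col x = c).image T := by
    rw [himg]; simpa using hj
  obtain ⟨x, hx, rfl⟩ := Finset.mem_image.1 this
  exact ⟨x, by simpa using hx, rfl⟩

/-- Polytabloids lie in the kernel of the maps that move one entry from row `T x` up to row `j`. -/
theorem tabloidCoeff_polytabloid_move (h2 : (2 : F) ≠ 0) (t : Tableau μ n) (T : Fin n → ℕ)
    {x : Fin n} {j : ℕ} (hj : j < T x) :
    tabloidCoeff F (polytabloid F t) T +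
      ∑ p ∈ Finset.univ.filter (fun p => T p = j),
        tabloidCoeff F (polytabloid F t) (T ∘ swap x p) = 0 := by
  set e := tabloidCoeff F (polytabloid F t) with he
  -- For `p ∈ P`, the function `T ∘ swap x p` gives `p` the value `T x` and every other element of
  -- `P` the value `j`.
  set P := insert x (Finset.univ.filter (fun p => T p = j)) with hP
  have hx : x ∉ Finset.univ.filter (fun p => T p = j) := by simp [hj.ne']
  have hsum : e T + ∑ p ∈ Finset.univ.filter (fun p => T p = j), e (T ∘ swap x p) =
      ∑ p ∈ P, e (T ∘ swap x p) := by
    rw [hP, Finset.sum_insert hx]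
    congr 2
    ext z
    simp
  have hPmem : ∀ p, p ∈ P ↔ p = x ∨ T p = j := by
    intro p; simp [hP]
  have hval : ∀ p ∈ P, ∀ q, (T ∘ swap x p) q = if q = p then T x else if q = x then j else T q := by
    intro p hp q
    rw [hPmem] at hp
    simp only [Function.comp_apply, swap_apply_def]
    split_ifs <;> grind
  have hqP : ∀ p ∈ P, ∀ q, q ≠ p → ((T ∘ swap x p) q = j ↔ q ∈ P) := by
    intro p hp q hqp
    rw [hval p hp, hPmem, if_neg hqp]
    split_ifs with h
    · simp [h]
    · simp [h]
  have hswap : ∀ p ∈ P, ∀ q ∈ P, q ≠ p → T ∘ swap x q = (T ∘ swap x p) ∘ swap p q := by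
    intro p hp q hq hqp
    ext z
    rw [hval q hq, Function.comp_apply (g := swap p q), hval p hp, swap_apply_def]
    rw [hPmem] at hp hq
    split_ifs <;> simp_all
  rw [hsum]
  -- If the term of `p` is nonzero, the column of `p` contains exactly one other element `q` of `P`.
  -- Summing over these partners changes nothing and makes the sum range over ordered pairs.
  have hS : ∑ p ∈ P, e (T ∘ swap x p) =
      ∑ p ∈ P, ∑ q ∈ P, if q ≠ p ∧ t.col q = t.col p then e (T ∘ swap x p) else 0 := by
    refine Finset.sum_congr rfl fun p hp => ?_
    by_cases h0 : e (T ∘ swap x p) = 0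
    · simp [h0]
    have hlt : T x < μ.colLen (t.col p) := by
      have := lt_colLen_of_tabloidCoeff_polytabloid_ne_zero h0 p
      rwa [hval p hp, if_pos rfl] at this
    obtain ⟨q, hqc, hqj⟩ := exists_of_tabloidCoeff_polytabloid_ne_zero h2 h0 (hj.trans hlt)
    have hqp : q ≠ p := by
      rintro rfl
      rw [hval q hp, if_pos rfl] at hqj
      exact hj.ne' hqj
    rw [Finset.sum_eq_single q]
    · rw [if_pos ⟨hqp, hqc⟩]
    · intro q' hq' hne
      rw [if_neg]
      rintro ⟨h3, h4⟩
      apply hne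
      refine eq_of_col_eq_of_tabloidCoeff_polytabloid_ne_zero h2 h0 (h4.trans hqc.symm) ?_
      rw [hqj, hqP p hp q' h3]
      exact hq'
    · intro h
      exact absurd ((hqP p hp q hqp).1 hqj) h
  -- Exchanging `p` and `q` reverses the sign of each term, so the sum is its own negative.
  apply eq_zero_of_eq_neg_self h2
  conv_lhs => rw [hS, Finset.sum_comm]
  rw [hS, ← Finset.sum_neg_distrib]
  refine Finset.sum_congr rfl fun p hp => ?_
  rw [← Finset.sum_neg_distrib]
  refine Finset.sum_congr rfl fun q hq => ?_
  by_cases h : q ≠ p ∧ t.col q = t.col p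
  · rw [if_pos h, if_pos ⟨h.1.symm, h.2.symm⟩, hswap p hp q hq h.1]
    exact tabloidCoeff_polytabloid_swap t h.1.symm h.2.symm _
  · rw [if_neg h, if_neg fun h' => h ⟨h'.1.symm, h'.2.symm⟩, neg_zero]

end Exchange

/-! ### Straightening a nonzero coefficient row by row. -/

section Straightening

variable {μ : YoungDiagram} {n : ℕ} {F : Type*} [Field F]

/-- If `v` is antisymmetric within the columns of `D`, the value `i` occurs in `D` at least as
often as there are elements of a transversal `A` of these columns, and `v T ≠ 0`, then the values
`i` can be moved to `A` by permuting within columns. -/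
theorem exists_value_on_transversal {X : Type*} [DecidableEq X] (h2 : (2 : F) ≠ 0)
    (v : (X → ℕ) → F) (col : X → ℕ) (A D : Finset X) (i : ℕ) (hAD : A ⊆ D)
    (hinj : Set.InjOn col A) (hcol : ∀ x ∈ D, ∃ a ∈ A, col a = col x)
    (hA : ∀ x ∈ D, ∀ y ∈ D, x ≠ y → col x = col y → ∀ T, v (T ∘ swap x y) = - v T)
    (T : X → ℕ) (hcard : A.card ≤ (D.filter fun x => T x = i).card) (hv : v T ≠ 0) :
    ∃ T', v T' ≠ 0 ∧ (∀ x, x ∉ D → T' x = T x) ∧ ∀ x ∈ A, T' x = i := by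
  -- Induction on the number of positions of `A` whose value is still wrong.
  induction hk : (A.filter fun x => T x ≠ i).card using Nat.strong_induction_on generalizing T with
  | _ k ih =>
  by_cases hall : ∀ a ∈ A, T a = i
  · exact ⟨T, hv, fun _ _ => rfl, hall⟩
  push Not at hall
  obtain ⟨a, ha, hai⟩ := hall
  have hTinj : ∀ x ∈ D, ∀ y ∈ D, col x = col y → T x = T y → x = y := by
    intro x hx y hy hc hT
    by_contra hxy
    apply hv
    apply eq_zero_of_eq_neg_self h2
    conv_lhs => rw [← comp_swap_of_eq T hT]
    exact hA x hx y hy hxy hc T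
  -- The values `i` lie in distinct columns and are at least as many as the columns met by `A`, so
  -- every column contains one.
  have himg : (D.filter fun x => T x = i).image col = A.image col := by
    apply Finset.eq_of_subset_of_card_le
    · intro c hc
      obtain ⟨x, hx, rfl⟩ := Finset.mem_image.1 hc
      obtain ⟨b, hb, hbx⟩ := hcol x (Finset.mem_filter.1 hx).1
      exact Finset.mem_image.2 ⟨b, hb, hbx⟩
    · refine Finset.card_image_le.trans (hcard.trans ?_)
      rw [Finset.card_image_of_injOn]
      intro x hx y hy hxy
      have hx' := Finset.mem_filter.1 hx
      have hy' := Finset.mem_filter.1 hy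
      exact hTinj x hx'.1 y hy'.1 hxy (hx'.2.trans hy'.2.symm)
  have hac : col a ∈ (D.filter fun x => T x = i).image col := by
    rw [himg]; exact Finset.mem_image_of_mem _ ha
  obtain ⟨q, hq, hqa⟩ := Finset.mem_image.1 hac
  rw [Finset.mem_filter] at hq
  have hne : a ≠ q := by
    rintro rfl; exact hai hq.2
  have hqA : q ∉ A := fun h => hne (hinj ha h hqa.symm)
  have hval : ∀ x, (T ∘ swap a q) x = if x = a then i else if x = q then T a else T x := by
    intro x
    rw [Function.comp_apply, swap_apply_def]
    split_ifs
    · exact hq.2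
    · rfl
    · rfl
  obtain ⟨T', h1, h3, h4⟩ := ih ((A.filter fun x => (T ∘ swap a q) x ≠ i).card) (by
      rw [← hk]
      apply Finset.card_lt_card
      rw [Finset.ssubset_iff_of_subset]
      · exact ⟨a, by simp [ha, hai], by simp [hq.2]⟩
      · intro x hx
        rw [Finset.mem_filter] at hx ⊢
        refine ⟨hx.1, fun h => hx.2 ?_⟩
        rw [hval]
        split_ifs with h5 h6
        · rfl
        · exact absurd (h6 ▸ hx.1) hqA
        · exact h)
    (T ∘ swap a q) (hcard.trans (by
      apply le_of_eq
      refine Finset.card_bij (fun x _ => swap a q x) ?_ ?_ ?_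
      · intro x hx
        rw [Finset.mem_filter] at hx ⊢
        refine ⟨?_, by simpa using hx.2⟩
        rw [swap_apply_def]
        split_ifs
        · exact hq.1
        · exact hAD ha
        · exact hx.1
      · intro x _ y _ h
        simpa using h
      · intro x hx
        rw [Finset.mem_filter] at hx
        refine ⟨swap a q x, ?_, by simp⟩
        rw [Finset.mem_filter]
        refine ⟨?_, by simpa using hx.2⟩
        rw [swap_apply_def]
        split_ifs
        · exact hq.1
        · exact hAD ha
        · exact hx.1))
    (by rw [hA a (hAD ha) q hq.1 hne hqa.symm]; exact neg_ne_zero.2 hv) rfl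
  refine ⟨T', h1, fun x hx => ?_, h4⟩
  rw [h3 x hx, hval, if_neg, if_neg]
  · rintro rfl; exact hx hq.1
  · rintro rfl; exact hx (hAD ha)

/-- Once `T` matches its target on `G`, subtraction shows that the remaining positions hold each
value as often as in the target. This supplies the counts that the straightening needs. -/
theorem card_filter_compl_eq {X : Type*} [Fintype X] [DecidableEq X] {T g : X → ℕ} {i : ℕ}
    (G : X → Prop) [DecidablePred G] (hG : ∀ x, G x → T x = g x)
    (hcard : (Finset.univ.filter fun x => T x = i).card =
      (Finset.univ.filter fun x => g x = i).card) :
    (Finset.univ.filter fun x => ¬ G x ∧ T x = i).card =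
      (Finset.univ.filter fun x => ¬ G x ∧ g x = i).card := by
  have key : ∀ f : X → ℕ, (Finset.univ.filter fun x => f x = i).card =
      (Finset.univ.filter fun x => G x ∧ f x = i).card +
      (Finset.univ.filter fun x => ¬ G x ∧ f x = i).card := by
    intro f
    rw [← Finset.card_union_of_disjoint]
    · congr 1
      ext x
      simp only [Finset.mem_filter, Finset.mem_univ, true_and, Finset.mem_union]
      tauto
    · rw [Finset.disjoint_filter]
      tauto
  have h1 : (Finset.univ.filter fun x => G x ∧ T x = i) =
      (Finset.univ.filter fun x => G x ∧ g x = i) := by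
    ext x
    simp only [Finset.mem_filter, Finset.mem_univ, true_and]
    constructor
    · rintro ⟨h, h'⟩; exact ⟨h, by rw [← hG x h]; exact h'⟩
    · rintro ⟨h, h'⟩; exact ⟨h, by rw [hG x h]; exact h'⟩
  rw [key T, key g, h1] at hcard
  omega

/-- Straightening by columns: outside a set `N` of entries, `v` is antisymmetric in the columns of
the tableau, and from row `i₀` on the target `g` is the row function. -/
theorem ne_zero_of_agree (h2 : (2 : F) ≠ 0) (t : Tableau μ n) (v : (Fin n → ℕ) → F)
    (N : Finset (Fin n)) (i₀ : ℕ) (g : Fin n → ℕ)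
    (hA : ∀ x ∉ N, ∀ y ∉ N, x ≠ y → t.col x = t.col y → ∀ T, v (T ∘ swap x y) = - v T)
    (hC : ∀ T, v T ≠ 0 → ∀ i, (Finset.univ.filter fun x => T x = i).card =
      (Finset.univ.filter fun x => g x = i).card)
    (hg : ∀ x ∉ N, i₀ ≤ t.row x → g x = t.row x)
    (hcl : ∀ x ∉ N, ∀ i, i₀ ≤ i → i ≤ t.row x → ∃ a ∉ N, t.row a = i ∧ t.col a = t.col x)
    (T : Fin n → ℕ) (hv : v T ≠ 0) (hT : ∀ x, (x ∈ N ∨ t.row x < i₀) → T x = g x) :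
    v g ≠ 0 := by
  -- Invariant: the coefficient stays nonzero while `T` is corrected on one more row at a time.
  have step : ∀ k, ∃ T, v T ≠ 0 ∧ ∀ x, (x ∈ N ∨ t.row x < i₀ + k) → T x = g x := by
    intro k
    induction k with
    | zero => exact ⟨T, hv, hT⟩
    | succ k ih =>
      obtain ⟨T, hv, hT⟩ := ih
      have hnot : ∀ x, ¬ (x ∈ N ∨ t.row x < i₀ + k) ↔ x ∉ N ∧ i₀ + k ≤ t.row x := by
        intro x; push Not; rfl
      have hcard := card_filter_compl_eq (fun x => x ∈ N ∨ t.row x < i₀ + k) hT (hC T hv (i₀ + k))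
      obtain ⟨T', h1, h3, h4⟩ := exists_value_on_transversal h2 v t.col
        (Finset.univ.filter fun x => x ∉ N ∧ t.row x = i₀ + k)
        (Finset.univ.filter fun x => x ∉ N ∧ i₀ + k ≤ t.row x) (i₀ + k)
        (by
          intro x hx
          simp only [Finset.mem_filter, Finset.mem_univ, true_and] at hx ⊢
          exact ⟨hx.1, hx.2.ge⟩)
        (by
          intro x hx y hy hxy
          simp only [Finset.coe_filter, Finset.mem_univ, true_and, Set.mem_ofPred_eq] at hx hy
          exact t.ext_row_col (hx.2.trans hy.2.symm) hxy)
        (by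
          intro x hx
          simp only [Finset.mem_filter, Finset.mem_univ, true_and] at hx
          obtain ⟨a, ha, har, hac⟩ := hcl x hx.1 (i₀ + k) (by omega) hx.2
          exact ⟨a, by simp [ha, har], hac⟩)
        (by
          intro x hx y hy
          simp only [Finset.mem_filter, Finset.mem_univ, true_and] at hx hy
          exact hA x hx.1 y hy.1)
        T
        (by
          rw [Finset.filter_filter]
          simp only [hnot] at hcard
          rw [hcard]
          apply Finset.card_le_card
          intro x hx
          simp only [Finset.mem_filter, Finset.mem_univ, true_and] at hx ⊢
          exact ⟨⟨hx.1, hx.2.ge⟩, by rw [hg x hx.1 (by omega), hx.2]⟩)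
        hv
      refine ⟨T', h1, fun x hx => ?_⟩
      by_cases hxG : x ∈ N ∨ t.row x < i₀ + k
      · rw [h3 x, hT x hxG]
        simp only [Finset.mem_filter, Finset.mem_univ, true_and]
        exact fun h => (hnot x).2 h hxG
      · have hx' := (hnot x).1 hxG
        have hrow : t.row x = i₀ + k := by
          rcases hx with hx | hx
          · exact absurd hx hx'.1
          · omega
        rw [h4 x (by simp [hx'.1, hrow]), hg x hx'.1 (by omega), hrow]
  obtain ⟨T, hv, hT⟩ := step (μ.colLen 0)
  have : T = g := by
    ext x
    apply hT x
    right
    have h1 := t.row_lt_colLen x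
    have h3 := μ.colLen_anti 0 (t.col x) (Nat.zero_le _)
    omega
  rwa [this] at hv

/-- Straightening with nothing frozen turns any nonzero coefficient into the one at `t.row`. Hence a
vector antisymmetric along the columns of `t` is determined by that coefficient. -/
theorem tabloidCoeff_row_ne_zero_of_antisymm (h2 : (2 : F) ≠ 0) (t : Tableau μ n)
    (m : MonoidAlgebra F (Tabloid μ n))
    (hA : ∀ x y, x ≠ y → t.col x = t.col y → ∀ T,
      tabloidCoeff F m (T ∘ swap x y) = - tabloidCoeff F m T) (hm : m ≠ 0) :
    tabloidCoeff F m t.row ≠ 0 := by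
  have : ∃ T, tabloidCoeff F m T ≠ 0 := by
    by_contra h
    push Not at h
    apply hm
    apply tabloidCoeff_injective
    ext T
    rw [h T, map_zero]
    rfl
  obtain ⟨T, hT⟩ := this
  refine ne_zero_of_agree h2 t (tabloidCoeff F m) ∅ 0 t.row (fun x _ y _ => hA x y) ?_ (by simp) ?_
    T hT (by simp)
  · intro T hT i
    rw [card_fiber_of_tabloidCoeff_ne_zero hT, t.card_row_filter]
  · intro x _ i _ hi
    obtain ⟨a, ha⟩ := t.exists_entry (μ.up_left_mem hi le_rfl (t.mem_diagram x))
    exact ⟨a, by simp, ha⟩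

end Straightening

/-! ### Uniqueness of maps out of the top layer of the branching filtration. -/

section ShiftedRow

variable {μ : YoungDiagram} {n : ℕ} {F : Type*} [Field F]

/-- `x` is the last entry of its row. -/
def Tableau.IsRowEnd (t : Tableau μ n) (x : Fin n) : Prop := t.col x + 1 = μ.rowLen (t.row x)

instance (t : Tableau μ n) : DecidablePred t.IsRowEnd :=
  fun _ => inferInstanceAs (Decidable (_ = _))

/-- `x` is a removable node of the diagram. -/
def Tableau.IsCorner (t : Tableau μ n) (x : Fin n) : Prop :=
  t.IsRowEnd x ∧ μ.rowLen (t.row x + 1) ≤ t.col x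

/-- The row function of `t` after shifting the last entries of the rows above `x₀` cyclically:
`x₀` moves to the top row, and the other row ends move down by one row. -/
def Tableau.shiftedRow (t : Tableau μ n) (x₀ x : Fin n) : ℕ :=
  if x = x₀ then 0 else if t.row x < t.row x₀ ∧ t.IsRowEnd x then t.row x + 1 else t.row x

theorem Tableau.shiftedRow_self (t : Tableau μ n) (x₀ : Fin n) : t.shiftedRow x₀ x₀ = 0 := by
  simp [Tableau.shiftedRow]

theorem Tableau.shiftedRow_of_isRowEnd (t : Tableau μ n) {x₀ x : Fin n}
    (h : t.row x < t.row x₀) (he : t.IsRowEnd x) : t.shiftedRow x₀ x = t.row x + 1 := by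
  have : x ≠ x₀ := by rintro rfl; exact lt_irrefl _ h
  simp [Tableau.shiftedRow, this, h, he]

theorem Tableau.shiftedRow_of_not_isRowEnd (t : Tableau μ n) {x₀ x : Fin n}
    (h : x ≠ x₀) (he : ¬ t.IsRowEnd x) : t.shiftedRow x₀ x = t.row x := by
  simp [Tableau.shiftedRow, h, he]

theorem Tableau.shiftedRow_of_le (t : Tableau μ n) {x₀ x : Fin n}
    (h : x ≠ x₀) (hr : t.row x₀ ≤ t.row x) : t.shiftedRow x₀ x = t.row x := by
  simp [Tableau.shiftedRow, h, hr]

theorem Tableau.exists_isRowEnd (t : Tableau μ n) (x₀ : Fin n) {u : ℕ} (hu : u ≤ t.row x₀) :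
    ∃ x, t.row x = u ∧ t.IsRowEnd x := by
  have h1 := t.col_lt_rowLen x₀
  have h2 := μ.rowLen_anti u (t.row x₀) hu
  obtain ⟨x, hx, hc⟩ := t.exists_entry (i := u) (j := μ.rowLen u - 1)
    (YoungDiagram.mem_iff_lt_rowLen.2 (by omega))
  refine ⟨x, hx, ?_⟩
  change _ + 1 = _
  rw [hc, hx]
  omega

theorem Tableau.IsRowEnd.eq {t : Tableau μ n} {x y : Fin n} (hx : t.IsRowEnd x)
    (hy : t.IsRowEnd y) (h : t.row x = t.row y) : x = y := by
  apply t.ext_row_col h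
  have h1 : t.col x + 1 = _ := hx
  have h2 : t.col y + 1 = _ := hy
  rw [h] at h1
  omega

/-- Each row down to that of `x₀` loses its last entry and gains one: the row end from the row above
or, for row zero, `x₀`. -/
theorem Tableau.card_shiftedRow (t : Tableau μ n) {x₀ : Fin n} (h₀ : t.IsRowEnd x₀) (u : ℕ) :
    (Finset.univ.filter fun x => t.shiftedRow x₀ x = u).card = μ.rowLen u := by
  rw [← t.card_row_filter]
  rcases le_or_gt u (t.row x₀) with hu | hu
  · obtain ⟨e, her, hee⟩ := t.exists_isRowEnd x₀ hu
    -- Here `e` is the row end that leaves row `u`, and `p` is the entry that arrives.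
    obtain ⟨p, hp, hpr⟩ : ∃ p, t.shiftedRow x₀ p = u ∧ ∀ x, t.shiftedRow x₀ x = u →
        x = p ∨ (t.row x = u ∧ ¬ t.IsRowEnd x) := by
      rcases Nat.eq_zero_or_pos u with rfl | hpos
      · refine ⟨x₀, t.shiftedRow_self x₀, fun x hx => ?_⟩
        by_cases hxx : x = x₀
        · exact Or.inl hxx
        right
        unfold Tableau.shiftedRow at hx
        rw [if_neg hxx] at hx
        split_ifs at hx with h
        refine ⟨hx, fun he => h ⟨?_, he⟩⟩
        by_contra h3
        exact hxx (he.eq h₀ (by omega))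
      · obtain ⟨p, hpr, hpe⟩ := t.exists_isRowEnd x₀ (u := u - 1) (by omega)
        refine ⟨p, by rw [t.shiftedRow_of_isRowEnd (by omega) hpe]; omega, fun x hx => ?_⟩
        have hxx : x ≠ x₀ := by
          rintro rfl
          rw [t.shiftedRow_self] at hx
          omega
        by_cases he : t.IsRowEnd x
        · left
          rcases lt_or_ge (t.row x) (t.row x₀) with h | h
          · rw [t.shiftedRow_of_isRowEnd h he] at hx
            exact he.eq hpe (by omega)
          · rw [t.shiftedRow_of_le hxx h] at hx
            exact absurd (he.eq h₀ (by omega)) hxx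
        · rw [t.shiftedRow_of_not_isRowEnd hxx he] at hx
          exact Or.inr ⟨hx, he⟩
    have hpe : p ∉ (Finset.univ.filter fun x => t.row x = u).erase e := by
      intro h
      rw [Finset.mem_erase, Finset.mem_filter] at h
      by_cases hpx : p = x₀
      · rw [hpx] at h
        exact h.1 (h₀.eq hee (h.2.2.trans her.symm))
      by_cases hpee : t.IsRowEnd p
      · exact h.1 (hpee.eq hee (h.2.2.trans her.symm))
      · have hc : (Finset.univ.filter fun x => t.row x = u).card = μ.rowLen u :=
          t.card_row_filter u
        rcases Nat.eq_zero_or_pos u with hu0 | hpos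
        · rcases hpr x₀ (by rw [t.shiftedRow_self, hu0]) with h5 | h5
          · exact hpx h5.symm
          · exact h5.2 h₀
        · obtain ⟨q, hqr, hqe⟩ := t.exists_isRowEnd x₀ (u := u - 1) (by omega)
          rcases hpr q (by rw [t.shiftedRow_of_isRowEnd (by omega) hqe]; omega) with h5 | h5
          · exact hpee (h5 ▸ hqe)
          · exact h5.2 hqe
    have : (Finset.univ.filter fun x => t.shiftedRow x₀ x = u) =
        insert p ((Finset.univ.filter fun x => t.row x = u).erase e) := by
      ext x
      simp only [Finset.mem_filter, Finset.mem_univ, true_and, Finset.mem_insert, Finset.mem_erase]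
      constructor
      · intro hx
        rcases hpr x hx with h | h
        · exact Or.inl h
        · refine Or.inr ⟨?_, h.1⟩
          rintro rfl
          exact h.2 hee
      · rintro (rfl | ⟨hxe, hxr⟩)
        · exact hp
        · have hxn : ¬ t.IsRowEnd x := fun he => hxe (he.eq hee (hxr.trans her.symm))
          rw [t.shiftedRow_of_not_isRowEnd (by rintro rfl; exact hxn h₀) hxn, hxr]
    rw [this, Finset.card_insert_of_notMem hpe, Finset.card_erase_of_mem (by simp [her])]
    have : 0 < (Finset.univ.filter fun x => t.row x = u).card :=
      Finset.card_pos.2 ⟨e, by simp [her]⟩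
    omega
  · congr 1
    ext x
    simp only [Finset.mem_filter, Finset.mem_univ, true_and]
    by_cases hxx : x = x₀
    · rw [hxx, t.shiftedRow_self]
      constructor <;> intro h <;> omega
    · rcases lt_or_ge (t.row x) (t.row x₀) with h | h
      · by_cases he : t.IsRowEnd x
        · rw [t.shiftedRow_of_isRowEnd h he]
          constructor <;> intro h <;> omega
        · rw [t.shiftedRow_of_not_isRowEnd hxx he]
      · rw [t.shiftedRow_of_le hxx h]

/-- Uniqueness of homomorphisms out of the top of the branching filtration: a coefficient function
`v` subject to the relations of a polytabloid away from the corner `x₀` and to the relations of the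
Specht module vanishes if its coefficient at the shifted row function vanishes. -/
theorem shiftedRow_ne_zero (h2 : (2 : F) ≠ 0) (t : Tableau μ n) (x₀ : Fin n)
    (h₀ : t.IsCorner x₀) (v : (Fin n → ℕ) → F)
    (hA : ∀ x y, x ≠ x₀ → y ≠ x₀ → x ≠ y → t.col x = t.col y → ∀ T, v (T ∘ swap x y) = - v T)
    (hC : ∀ T, v T ≠ 0 → ∀ i, (Finset.univ.filter fun x => T x = i).card = μ.rowLen i)
    (hK : ∀ T x j, j < T x →
      v T + ∑ p ∈ Finset.univ.filter (fun p => T p = j), v (T ∘ swap x p) = 0)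
    (hG : ∀ y c, y ≠ x₀ → t.col y = c + 1 → ∀ T,
      v T = ∑ z ∈ Finset.univ.filter (fun z => z ≠ x₀ ∧ t.col z = c), v (T ∘ swap y z))
    (T : Fin n → ℕ) (hv : v T ≠ 0) : v (t.shiftedRow x₀) ≠ 0 := by
  obtain ⟨he₀, hc₀⟩ := h₀
  have hC' : ∀ T, v T ≠ 0 → ∀ i, (Finset.univ.filter fun x => T x = i).card =
      (Finset.univ.filter fun x => t.shiftedRow x₀ x = i).card := fun T hT i => by
    rw [hC T hT, t.card_shiftedRow he₀]
  have hinj : ∀ T, v T ≠ 0 → ∀ x y, x ≠ x₀ → y ≠ x₀ → t.col x = t.col y → T x = T y → x = y := by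
    intro T hT x y hx hy hc hxy
    by_contra hne
    apply hT
    apply eq_zero_of_eq_neg_self h2
    conv_lhs => rw [← comp_swap_of_eq T hxy]
    exact hA x y hx hy hne hc T
  have hKex : ∀ T, v T ≠ 0 → ∀ x j, j < T x → ∃ p, T p = j ∧ v (T ∘ swap x p) ≠ 0 := by
    intro T hT x j hj
    have hs : ∑ p ∈ Finset.univ.filter (fun p => T p = j), v (T ∘ swap x p) ≠ 0 := by
      intro hs
      have := hK T x j hj
      rw [hs, add_zero] at this
      exact hT this
    obtain ⟨p, hp, hp0⟩ := Finset.exists_ne_zero_of_sum_ne_zero hs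
    exact ⟨p, by simpa using hp, hp0⟩
  -- The target is reached from the top row down. The kernel relations `hK` place 0 at `x₀` and
  -- later `i + 1` at the end of row `i`; the exchange relations `hG` and antisymmetry place the
  -- values `i` in the rest of row `i`.
  have step : ∀ i, i ≤ t.row x₀ → ∃ T, v T ≠ 0 ∧
      ∀ x, (x = x₀ ∨ t.row x < i) → T x = t.shiftedRow x₀ x := by
    intro i
    induction i with
    | zero =>
      intro _
      rcases Nat.eq_zero_or_pos (T x₀) with h0 | hpos
      · refine ⟨T, hv, ?_⟩
        rintro x (rfl | h)
        · rw [h0, t.shiftedRow_self]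
        · omega
      · obtain ⟨p, hp, hp0⟩ := hKex T hv x₀ 0 hpos
        refine ⟨_, hp0, ?_⟩
        rintro x (rfl | h)
        · rw [Function.comp_apply, swap_apply_left, hp, t.shiftedRow_self]
        · omega
    | succ i ih =>
      intro hi
      replace ih := ih (by omega)
      -- One value `i` is already used, by the end of the row above or by `x₀` when `i = 0`.
      have hrest : ∀ T, v T ≠ 0 → (∀ x, (x = x₀ ∨ t.row x < i) → T x = t.shiftedRow x₀ x) →
          (Finset.univ.filter fun x => ¬ (x = x₀ ∨ t.row x < i) ∧ T x = i).card + 1 =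
            μ.rowLen i := by
        intro T hT hp
        rw [card_filter_compl_eq _ hp (hC' T hT i)]
        obtain ⟨e, her, hee⟩ := t.exists_isRowEnd x₀ (u := i) (by omega)
        have : (Finset.univ.filter fun x => ¬ (x = x₀ ∨ t.row x < i) ∧ t.shiftedRow x₀ x = i) =
            (Finset.univ.filter fun x => t.row x = i).erase e := by
          ext x
          simp only [Finset.mem_filter, Finset.mem_univ, true_and, Finset.mem_erase]
          constructor
          · rintro ⟨h, hx⟩
            push Not at h
            by_cases hxe : t.IsRowEnd x
            · rcases lt_or_ge (t.row x) (t.row x₀) with h3 | h3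
              · rw [t.shiftedRow_of_isRowEnd h3 hxe] at hx
                omega
              · rw [t.shiftedRow_of_le h.1 h3] at hx
                omega
            · rw [t.shiftedRow_of_not_isRowEnd h.1 hxe] at hx
              exact ⟨by rintro rfl; exact hxe hee, hx⟩
          · rintro ⟨hxe, hxr⟩
            have hxn : ¬ t.IsRowEnd x := fun he => hxe (he.eq hee (hxr.trans her.symm))
            have hxx : x ≠ x₀ := by rintro rfl; exact hxn he₀
            refine ⟨?_, by rw [t.shiftedRow_of_not_isRowEnd hxx hxn, hxr]⟩
            push Not
            exact ⟨hxx, hxr.ge⟩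
        rw [this, Finset.card_erase_of_mem (by simp [her]), t.card_row_filter]
        have := t.col_lt_rowLen e
        rw [her] at this
        omega
      have hlen : 0 < μ.rowLen i := by
        obtain ⟨T, hT, hp⟩ := ih
        have := hrest T hT hp
        omega
      -- the column without the value `i` can be moved to the last column
      have hmove : ∀ k c, c + k + 1 = μ.rowLen i → ∀ T, v T ≠ 0 →
          (∀ x, (x = x₀ ∨ t.row x < i) → T x = t.shiftedRow x₀ x) →
          (∀ x, x ≠ x₀ → i ≤ t.row x → t.col x = c → T x ≠ i) →
          ∃ T, v T ≠ 0 ∧ (∀ x, (x = x₀ ∨ t.row x < i) → T x = t.shiftedRow x₀ x) ∧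
            ∀ x, x ≠ x₀ → i ≤ t.row x → t.col x + 1 = μ.rowLen i → T x ≠ i := by
        intro k
        induction k with
        | zero =>
          intro c hck T hT hp hl
          exact ⟨T, hT, hp, fun x h1 h3 h4 => hl x h1 h3 (by omega)⟩
        | succ k ihk =>
          intro c hck T hT hp hl
          by_cases hl' : ∀ x, x ≠ x₀ → i ≤ t.row x → t.col x = c + 1 → T x ≠ i
          · exact ihk (c + 1) (by omega) T hT hp hl'
          push Not at hl'
          obtain ⟨y, hy₀, hyr, hyc, hyi⟩ := hl'
          rw [hG y c hy₀ hyc T] at hT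
          obtain ⟨z, hz, hz0⟩ := Finset.exists_ne_zero_of_sum_ne_zero hT
          rw [← hG y c hy₀ hyc T] at hT
          simp only [Finset.mem_filter, Finset.mem_univ, true_and] at hz
          obtain ⟨hz₀, hzc⟩ := hz
          have hyz : y ≠ z := by rintro rfl; omega
          rcases le_or_gt i (t.row z) with hzr | hzr
          · refine ihk (c + 1) (by omega) _ hz0 ?_ ?_
            · intro x hx
              rw [Function.comp_apply, swap_apply_of_ne_of_ne]
              · exact hp x hx
              · rintro rfl
                rcases hx with hx | hx
                · exact hy₀ hx
                · omega
              · rintro rfl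
                rcases hx with hx | hx
                · exact hz₀ hx
                · omega
            · intro x hx₀ hxr hxc
              rcases eq_or_ne x y with rfl | hxy
              · rw [Function.comp_apply, swap_apply_left]
                exact hl z hz₀ hzr hzc
              · have hxz : x ≠ z := by rintro rfl; omega
                rw [Function.comp_apply, swap_apply_of_ne_of_ne hxy hxz]
                intro hxi
                exact hxy (hinj T hT x y hx₀ hy₀ (hxc.trans hyc.symm) (hxi.trans hyi.symm))
          -- If `z` lies in the frozen rows, some column has a repeated value. Its right neighbour
          -- `z'` has the same value as `z` unless `z'` is a row end, so the swap creates a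
          -- repetition in column `c + 1`. If `z'` is a row end, all rows from that of `z` to row
          -- `i` end in column `c + 1`; the end of row `i - 1` already carries `i`, as does `y`.
          · exfalso
            have han := μ.rowLen_anti (t.row z) i hzr.le
            have hze : ¬ t.IsRowEnd z := by
              intro h
              have h' : t.col z + 1 = _ := h
              omega
            have hTz : T z = t.row z := by
              rw [hp z (Or.inr hzr), t.shiftedRow_of_not_isRowEnd hz₀ hze]
            obtain ⟨z', hz'r, hz'c⟩ := t.exists_entry (i := t.row z) (j := c + 1)
              (YoungDiagram.mem_iff_lt_rowLen.2 (by omega))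
            have hz'₀ : z' ≠ x₀ := by rintro rfl; omega
            by_cases hz'e : t.IsRowEnd z'
            · have hz'e' : t.col z' + 1 = μ.rowLen (t.row z') := hz'e
              have han' := μ.rowLen_anti (t.row z) (i - 1) (by omega)
              have han'' := μ.rowLen_anti (i - 1) i (by omega)
              obtain ⟨w, hwr, hwc⟩ := t.exists_entry (i := i - 1) (j := c + 1)
                (YoungDiagram.mem_iff_lt_rowLen.2 (by omega))
              have hw₀ : w ≠ x₀ := by rintro rfl; omega
              have hwe : t.IsRowEnd w := by
                change t.col w + 1 = μ.rowLen (t.row w)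
                rw [hz'c, hz'r] at hz'e'
                rw [hwc, hwr]
                omega
              have hTw : T w = i := by
                rw [hp w (Or.inr (by omega)), t.shiftedRow_of_isRowEnd (by omega) hwe]
                omega
              have := hinj T hT w y hw₀ hy₀ (hwc.trans hyc.symm) (hTw.trans hyi.symm)
              rw [this] at hwr
              omega
            · have hTz' : T z' = t.row z := by
                rw [hp z' (Or.inr (by omega)), t.shiftedRow_of_not_isRowEnd hz'₀ hz'e, hz'r]
              have hz'y : z' ≠ y := by rintro rfl; omega
              have hz'z : z' ≠ z := by rintro rfl; omega
              apply hz'y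
              apply hinj _ hz0 z' y hz'₀ hy₀ (hz'c.trans hyc.symm)
              rw [Function.comp_apply, Function.comp_apply, swap_apply_left,
                swap_apply_of_ne_of_ne hz'y hz'z, hTz, hTz']
      obtain ⟨T, hT, hp, hl⟩ : ∃ T, v T ≠ 0 ∧
          (∀ x, (x = x₀ ∨ t.row x < i) → T x = t.shiftedRow x₀ x) ∧
            ∀ x, x ≠ x₀ → i ≤ t.row x → t.col x + 1 = μ.rowLen i → T x ≠ i := by
        obtain ⟨T, hT, hp⟩ := ih
        -- Only `rowLen i - 1` values `i` are available for `rowLen i` columns.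
        have hex : ∃ c < μ.rowLen i, ∀ x, x ≠ x₀ → i ≤ t.row x → t.col x = c → T x ≠ i := by
          by_contra hcon
          push Not at hcon
          have hsub : Finset.range (μ.rowLen i) ⊆
              (Finset.univ.filter fun x => ¬ (x = x₀ ∨ t.row x < i) ∧ T x = i).image t.col := by
            intro c hc
            obtain ⟨x, h1, h3, h4, h5⟩ := hcon c (by simpa using hc)
            refine Finset.mem_image.2 ⟨x, ?_, h4⟩
            simp only [Finset.mem_filter, Finset.mem_univ, true_and]
            refine ⟨?_, h5⟩
            push Not
            exact ⟨h1, h3⟩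
          have h3 := (Finset.card_le_card hsub).trans Finset.card_image_le
          rw [Finset.card_range] at h3
          have := hrest T hT hp
          omega
        obtain ⟨c, hc, hl⟩ := hex
        exact hmove (μ.rowLen i - c - 1) c (by omega) T hT hp hl
      -- the values `i` are moved to row `i`
      obtain ⟨T', hT', hT'1, hT'2⟩ := exists_value_on_transversal h2 v t.col
        (Finset.univ.filter fun x => t.row x = i ∧ t.col x + 1 < μ.rowLen i)
        (Finset.univ.filter fun x => x ≠ x₀ ∧ i ≤ t.row x ∧ t.col x + 1 < μ.rowLen i) i
        (by
          intro x hx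
          simp only [Finset.mem_filter, Finset.mem_univ, true_and] at hx ⊢
          exact ⟨by rintro rfl; omega, hx.1.ge, hx.2⟩)
        (by
          intro x hx y hy hxy
          simp only [Finset.coe_filter, Finset.mem_univ, true_and, Set.mem_ofPred_eq] at hx hy
          exact t.ext_row_col (hx.1.trans hy.1.symm) hxy)
        (by
          intro x hx
          simp only [Finset.mem_filter, Finset.mem_univ, true_and] at hx
          obtain ⟨a, har, hac⟩ := t.exists_entry (i := i) (j := t.col x)
            (YoungDiagram.mem_iff_lt_rowLen.2 (by omega))
          exact ⟨a, by simp [har, hac, hx.2.2], hac⟩)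
        (by
          intro x hx y hy
          simp only [Finset.mem_filter, Finset.mem_univ, true_and] at hx hy
          exact hA x y hx.1 hy.1)
        T
        (by
          have h3 := hrest T hT hp
          have h4 : (Finset.univ.filter fun x => t.row x = i ∧ t.col x + 1 < μ.rowLen i).card ≤
              (Finset.range (μ.rowLen i - 1)).card := by
            apply Finset.card_le_card_of_injOn t.col
            · intro x hx
              simp only [Finset.coe_filter, Finset.mem_univ, true_and, Set.mem_ofPred_eq] at hx
              simp only [Finset.coe_range, Set.mem_Iio]
              omega
            · intro x hx y hy hxy
              simp only [Finset.coe_filter, Finset.mem_univ, true_and, Set.mem_ofPred_eq] at hx hy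
              exact t.ext_row_col (hx.1.trans hy.1.symm) hxy
          rw [Finset.card_range] at h4
          have h5 : (Finset.univ.filter fun x => ¬ (x = x₀ ∨ t.row x < i) ∧ T x = i) ⊆
              ((Finset.univ.filter fun x => x ≠ x₀ ∧ i ≤ t.row x ∧ t.col x + 1 < μ.rowLen i).filter
                fun x => T x = i) := by
            intro x hx
            simp only [Finset.mem_filter, Finset.mem_univ, true_and] at hx ⊢
            obtain ⟨hx1, hx2⟩ := hx
            push Not at hx1
            refine ⟨⟨hx1.1, hx1.2, ?_⟩, hx2⟩
            have h6 := t.col_lt_rowLen x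
            have h7 := μ.rowLen_anti i (t.row x) hx1.2
            have h8 : t.col x + 1 ≠ μ.rowLen i := fun h => hl x hx1.1 hx1.2 h hx2
            omega
          have h6 := Finset.card_le_card h5
          omega)
        hT
      have hG' : ∀ x, (x = x₀ ∨ t.row x < i ∨ (t.row x = i ∧ ¬ t.IsRowEnd x)) →
          T' x = t.shiftedRow x₀ x := by
        intro x hx
        by_cases hx' : x = x₀ ∨ t.row x < i
        · rw [hT'1 x, hp x hx']
          simp only [Finset.mem_filter, Finset.mem_univ, true_and]
          rintro ⟨h1, h3, h4⟩
          rcases hx' with h | h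
          · exact h1 h
          · omega
        · have hx'' : t.row x = i ∧ ¬ t.IsRowEnd x := by tauto
          have hxx : x ≠ x₀ := fun h => hx' (Or.inl h)
          rw [t.shiftedRow_of_not_isRowEnd hxx hx''.2, hx''.1]
          apply hT'2
          have h4 := t.col_lt_rowLen x
          have h5 : t.col x + 1 ≠ μ.rowLen (t.row x) := hx''.2
          rw [hx''.1] at h4 h5
          simp only [Finset.mem_filter, Finset.mem_univ, true_and]
          exact ⟨hx''.1, by omega⟩
      obtain ⟨e, her, hee⟩ := t.exists_isRowEnd x₀ (u := i) (by omega)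
      have he₀' : e ≠ x₀ := by rintro rfl; omega
      have hle : ∀ x, (x = x₀ ∨ t.row x < i ∨ (t.row x = i ∧ ¬ t.IsRowEnd x)) →
          t.shiftedRow x₀ x ≤ i := by
        intro x hx
        unfold Tableau.shiftedRow
        split_ifs with h1 h3
        · omega
        · rcases hx with h | h | h
          · exact absurd h h1
          · omega
          · exact absurd h3.2 h.2
        · rcases hx with h | h | h
          · exact absurd h h1
          · omega
          · omega
      -- In the target, all positions still unsettled have values above `i`, and the counts of each
      -- value agree.
      have hTe : i < T' e := by
        by_contra hcon
        push Not at hcon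
        have hcard := card_filter_compl_eq
          (fun x => x = x₀ ∨ t.row x < i ∨ (t.row x = i ∧ ¬ t.IsRowEnd x)) hG' (hC' T' hT' (T' e))
        have h3 : 0 < (Finset.univ.filter fun x =>
            ¬ (x = x₀ ∨ t.row x < i ∨ (t.row x = i ∧ ¬ t.IsRowEnd x)) ∧ T' x = T' e).card := by
          apply Finset.card_pos.2 ⟨e, ?_⟩
          simp only [Finset.mem_filter, Finset.mem_univ, true_and, and_true]
          push Not
          exact ⟨he₀', her.ge, fun _ => hee⟩
        rw [hcard] at h3
        obtain ⟨x, hx⟩ := Finset.card_pos.1 h3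
        simp only [Finset.mem_filter, Finset.mem_univ, true_and] at hx
        obtain ⟨hx1, hx2⟩ := hx
        push Not at hx1
        unfold Tableau.shiftedRow at hx2
        rw [if_neg hx1.1] at hx2
        split_ifs at hx2 with h4
        · omega
        · have h5 : t.row x = i := by omega
          exact h4 ⟨by omega, hx1.2.2 h5⟩
      have hfin : ∀ S : Fin n → ℕ, (∀ x, (x = x₀ ∨ t.row x < i ∨ (t.row x = i ∧ ¬ t.IsRowEnd x)) →
          S x = t.shiftedRow x₀ x) → S e = i + 1 →
          ∀ x, (x = x₀ ∨ t.row x < i + 1) → S x = t.shiftedRow x₀ x := by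
        intro S hS hSe x hx
        by_cases hxe : x = e
        · rw [hxe, hSe, t.shiftedRow_of_isRowEnd (by omega) hee, her]
        · apply hS
          rcases hx with h | h
          · exact Or.inl h
          · rcases Nat.lt_succ_iff_lt_or_eq.1 h with h | h
            · exact Or.inr (Or.inl h)
            · exact Or.inr (Or.inr ⟨h, fun h' => hxe (h'.eq hee (h.trans her.symm))⟩)
      rcases Nat.eq_or_lt_of_le (Nat.succ_le_of_lt hTe) with h | h
      · exact ⟨T', hT', hfin T' hG' h.symm⟩
      -- The settled positions have values at most `i`, so the entry `p` exchanged with `e` is not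
      -- one of them.
      · obtain ⟨p, hpT, hp0⟩ := hKex T' hT' e (i + 1) h
        refine ⟨_, hp0, hfin _ ?_ ?_⟩
        · intro x hx
          rw [Function.comp_apply, swap_apply_of_ne_of_ne]
          · exact hG' x hx
          · rintro rfl
            rcases hx with h | h | h
            · exact he₀' h
            · omega
            · exact h.2 hee
          · rintro rfl
            have := hle x hx
            rw [← hG' x hx, hpT] at this
            omega
        · rw [Function.comp_apply, swap_apply_left, hpT]
  obtain ⟨T, hT, hp⟩ := step (t.row x₀) le_rfl
  -- From the row of `x₀` on, the target is the row function except at `x₀`. Freezing `x₀` leaves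
  -- intact columns because no entry lies below a corner.
  refine ne_zero_of_agree h2 t v {x₀} (t.row x₀) (t.shiftedRow x₀) ?_ hC' ?_ ?_ T hT ?_
  · intro x hx y hy
    exact hA x y (by simpa using hx) (by simpa using hy)
  · intro x hx hr
    exact t.shiftedRow_of_le (by simpa using hx) hr
  · intro x hx i hi hix
    obtain ⟨a, ha⟩ := t.exists_entry (μ.up_left_mem hix le_rfl (t.mem_diagram x))
    refine ⟨a, ?_, ha⟩
    rw [Finset.mem_singleton]
    rintro rfl
    rcases Nat.eq_or_lt_of_le hix with h | h
    · exact hx (by rw [Finset.mem_singleton]; exact t.ext_row_col (by omega) ha.2.symm)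
    · have h3 := t.col_lt_rowLen x
      have h4 := μ.rowLen_anti (t.row a + 1) (t.row x) (by omega)
      omega
  · intro x hx
    exact hp x (by simpa using hx)

end ShiftedRow

/-! ### Relations in the Specht module and its scalar endomorphisms. -/

section Polynomials

variable {μ : YoungDiagram} {n : ℕ} {F : Type*} [Field F]

/-- The coefficients of an element of the Specht module. -/
def spechtCoeff : SpechtModule F μ n →ₗ[F] ((Fin n → ℕ) → F) :=
  tabloidCoeff F ∘ₗ (spechtSub F μ n).toSubmodule.subtype

theorem spechtCoeff_injective :
    Function.Injective (spechtCoeff : SpechtModule F μ n →ₗ[F] _) :=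
  tabloidCoeff_injective.comp Subtype.val_injective

theorem spechtCoeff_ext {v w : SpechtModule F μ n} (h : ∀ T, spechtCoeff v T = spechtCoeff w T) :
    v = w :=
  spechtCoeff_injective (funext h)

theorem spechtCoeff_rep (σ : Perm (Fin n)) (v : SpechtModule F μ n) (T : Fin n → ℕ) :
    spechtCoeff (spechtRep F μ n σ v) T = spechtCoeff v (T ∘ σ) :=
  tabloidCoeff_permutationRep _ σ T

theorem card_fiber_of_spechtCoeff_ne_zero {v : SpechtModule F μ n} {T : Fin n → ℕ}
    (h : spechtCoeff v T ≠ 0) (i : ℕ) :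
    (Finset.univ.filter fun x => T x = i).card = μ.rowLen i :=
  card_fiber_of_tabloidCoeff_ne_zero h i

variable (F) in
/-- The polytabloid as an element of the Specht module. -/
def spechtPoly (t : Tableau μ n) : SpechtModule F μ n :=
  ⟨polytabloid F t, Submodule.subset_span ⟨t, rfl⟩⟩

theorem spechtCoeff_spechtPoly (t : Tableau μ n) (T : Fin n → ℕ) :
    spechtCoeff (spechtPoly F t) T = tabloidCoeff F (polytabloid F t) T := rfl

theorem spechtRep_spechtPoly (σ : Perm (Fin n)) (t : Tableau μ n) :
    spechtRep F μ n σ (spechtPoly F t) = spechtPoly F (t.trans σ) :=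
  Subtype.ext (permutationRep_polytabloid F σ t)

theorem span_spechtPoly :
    Submodule.span F (Set.range fun t : Tableau μ n => spechtPoly F t) = ⊤ := by
  have h := Submodule.span_range_subtype_eq_top_iff (spechtSub F μ n).toSubmodule
    (s := fun t : Tableau μ n => polytabloid F t)
    (fun t => Submodule.subset_span ⟨t, rfl⟩)
  exact h.2 rfl

theorem spechtModule_hom_ext {M : Type*} [AddCommMonoid M] [Module F M]
    {f g : SpechtModule F μ n →ₗ[F] M}
    (h : ∀ t : Tableau μ n, f (spechtPoly F t) = g (spechtPoly F t)) : f = g :=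
  LinearMap.ext_on_range span_spechtPoly h

theorem spechtPoly_trans_swap (t : Tableau μ n) {x y : Fin n} (hxy : x ≠ y)
    (h : t.col x = t.col y) : spechtPoly F (t.trans (swap x y)) = - spechtPoly F t := by
  apply spechtCoeff_ext
  intro T
  rw [← spechtRep_spechtPoly, spechtCoeff_rep, map_neg]
  exact tabloidCoeff_polytabloid_swap t hxy h T

theorem spechtPoly_exchange (h2 : (2 : F) ≠ 0) (t : Tableau μ n) {c : ℕ}
    {y : Fin n} (hc : c ≠ t.col y) (hlen : μ.colLen (t.col y) ≤ μ.colLen c) :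
    spechtPoly F t = ∑ z ∈ Finset.univ.filter (fun z => t.col z = c),
        spechtPoly F (t.trans (swap y z)) := by
  apply spechtCoeff_ext
  intro T
  rw [map_sum, Finset.sum_apply, spechtCoeff_spechtPoly,
    tabloidCoeff_polytabloid_exchange h2 t hc hlen T]
  refine Finset.sum_congr rfl fun z _ => ?_
  rw [← spechtRep_spechtPoly, spechtCoeff_rep]
  rfl

theorem spechtCoeff_move (h2 : (2 : F) ≠ 0) (v : SpechtModule F μ n) (T : Fin n → ℕ)
    {x : Fin n} {j : ℕ} (hj : j < T x) :
    spechtCoeff v T +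
      ∑ p ∈ Finset.univ.filter (fun p => T p = j), spechtCoeff v (T ∘ swap x p) = 0 := by
  have hv : v ∈ Submodule.span F (Set.range fun t : Tableau μ n => spechtPoly F t) := by
    rw [span_spechtPoly]; trivial
  induction hv using Submodule.span_induction with
  | mem w hw =>
    obtain ⟨t, rfl⟩ := hw
    exact tabloidCoeff_polytabloid_move h2 t T hj
  | zero => simp
  | add a b _ _ ha hb =>
    simp only [map_add, Pi.add_apply, Finset.sum_add_distrib]
    linear_combination ha + hb
  | smul r a _ ha =>
    simp only [map_smul, Pi.smul_apply, smul_eq_mul, ← Finset.mul_sum]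
    linear_combination r * ha

/-- The endomorphism ring of a Specht module consists of scalars in characteristic not two. -/
theorem exists_eq_smul_of_commute (h2 : (2 : F) ≠ 0)
    (f : SpechtModule F μ n →ₗ[F] SpechtModule F μ n)
    (hf : ∀ σ v, f (spechtRep F μ n σ v) = spechtRep F μ n σ (f v)) :
    ∃ a : F, ∀ v, f v = a • v := by
  by_cases hne : Nonempty (Tableau μ n)
  · obtain ⟨t⟩ := hne
    -- The polytabloid has coefficient 1 at `t.row`, so subtracting `a` times it leaves an
    -- antisymmetric vector whose coefficient there is zero.
    set a := spechtCoeff (f (spechtPoly F t)) t.row with ha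
    have h0 : f (spechtPoly F t) - a • spechtPoly F t = 0 := by
      by_contra h
      refine tabloidCoeff_row_ne_zero_of_antisymm h2 t
        (f (spechtPoly F t) - a • spechtPoly F t : SpechtModule F μ n).1 ?_
        (fun h' => h (Subtype.ext h')) ?_
      · intro x y hxy hc T
        change spechtCoeff (f (spechtPoly F t) - a • spechtPoly F t) (T ∘ swap x y) =
          - spechtCoeff (f (spechtPoly F t) - a • spechtPoly F t) T
        rw [← spechtCoeff_rep, map_sub, map_smul, ← hf, spechtRep_spechtPoly,
          spechtPoly_trans_swap t hxy hc, map_neg, smul_neg, neg_sub_neg,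
          ← neg_sub, map_neg]
        rfl
      · change spechtCoeff (f (spechtPoly F t) - a • spechtPoly F t) t.row = 0
        rw [map_sub, map_smul, Pi.sub_apply, Pi.smul_apply, spechtCoeff_spechtPoly,
          tabloidCoeff_polytabloid_row, ← ha]
        simp
    refine ⟨a, fun v => ?_⟩
    have : f = a • LinearMap.id := by
      apply spechtModule_hom_ext
      intro s
      have hs : s = t.trans (t.symm.trans s) := by ext; simp
      rw [hs, ← spechtRep_spechtPoly, hf, sub_eq_zero.1 h0]
      simp
    rw [this]
    rfl
  · refine ⟨0, fun v => ?_⟩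
    have : f = 0 := spechtModule_hom_ext fun s => absurd ⟨s⟩ hne
    rw [this]
    simp

end Polynomials

/-! ### The Jucys–Murphy operator and the filtration by column length. -/

section JucysMurphy

variable {μ : YoungDiagram} {n : ℕ} {F : Type*} [Field F]

theorem commute_aeval {A : Type*} [Ring A] [Algebra F A] {x y : A} (h : Commute x y)
    (p : Polynomial F) : Commute (Polynomial.aeval x p) y := by
  induction p using Polynomial.induction_on' with
  | add p q hp hq => rw [map_add]; exact hp.add_left hq
  | monomial k a =>
    rw [Polynomial.aeval_monomial]
    exact Commute.mul_left (Algebra.commutes a y) (h.pow_left k)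

/-- The sum of the transpositions that move `l`, acting on the Specht module. -/
def jucysMurphy (F : Type*) [Field F] (μ : YoungDiagram) {n : ℕ} (l : Fin n) :
    Module.End F (SpechtModule F μ n) :=
  ∑ x ∈ Finset.univ.erase l, spechtRep F μ n (swap l x)

theorem jucysMurphy_apply (l : Fin n) (v : SpechtModule F μ n) :
    jucysMurphy F μ l v = ∑ x ∈ Finset.univ.erase l, spechtRep F μ n (swap l x) v := by
  simp [jucysMurphy]

/-- Conjugation by a permutation fixing `l` permutes the transpositions that move `l`. -/
theorem jucysMurphy_spechtRep {l : Fin n} {σ : Perm (Fin n)} (hσ : σ l = l)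
    (v : SpechtModule F μ n) :
    jucysMurphy F μ l (spechtRep F μ n σ v) = spechtRep F μ n σ (jucysMurphy F μ l v) := by
  rw [jucysMurphy_apply, jucysMurphy_apply, map_sum]
  refine Finset.sum_bij (fun x _ => σ⁻¹ x) ?_ ?_ ?_ ?_
  · intro x hx
    simp only [Finset.mem_erase, Finset.mem_univ, and_true] at hx ⊢
    intro h
    apply hx
    rw [← hσ, ← h]
    simp
  · intro x _ y _ h
    simpa using h
  · intro x hx
    simp only [Finset.mem_erase, Finset.mem_univ, and_true] at hx
    refine ⟨σ x, ?_, by simp⟩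
    simp only [Finset.mem_erase, Finset.mem_univ, and_true]
    intro h
    exact hx (σ.injective (h.trans hσ.symm))
  · intro x _
    rw [← Module.End.mul_apply, ← Module.End.mul_apply, ← map_mul, ← map_mul]
    congr 2
    have h := swap_apply_apply σ l (σ⁻¹ x)
    rw [hσ, show σ (σ⁻¹ x) = x from σ.apply_symm_apply x] at h
    rw [h]
    simp

theorem aeval_jucysMurphy_spechtRep {l : Fin n} {σ : Perm (Fin n)} (hσ : σ l = l)
    (p : Polynomial F) (v : SpechtModule F μ n) :
    Polynomial.aeval (jucysMurphy F μ l) p (spechtRep F μ n σ v) =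
      spechtRep F μ n σ (Polynomial.aeval (jucysMurphy F μ l) p v) := by
  have h : Commute (jucysMurphy F μ l) (spechtRep F μ n σ) :=
    LinearMap.ext fun v => jucysMurphy_spechtRep hσ v
  exact LinearMap.congr_fun (commute_aeval h p) v

/-- The content that `jucysMurphy` contributes when `l` lies in a column of length `k`. -/
def columnContent (μ : YoungDiagram) (k : ℕ) : ℤ :=
  (∑ c ∈ Finset.range (μ.rowLen 0), if k ≤ μ.colLen c then 1 else 0) - k

/-- Group the transpositions by the column of the other entry. With k the length of its own column,
that column gives `1 - k` by antisymmetry. Any other column of length at least k gives 1 by the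
exchange relation, and a shorter column only moves `l` into that shorter column. -/
theorem jucysMurphy_spechtPoly (h2 : (2 : F) ≠ 0) (l : Fin n) (t : Tableau μ n) :
    jucysMurphy F μ l (spechtPoly F t) -
        (columnContent μ (μ.colLen (t.col l)) : F) • spechtPoly F t ∈
      Submodule.span F (spechtPoly F '' {s : Tableau μ n |
        μ.colLen (s.col l) < μ.colLen (t.col l)}) := by
  set W := Submodule.span F (spechtPoly F '' {s : Tableau μ n |
        μ.colLen (s.col l) < μ.colLen (t.col l)}) with hW
  have hlr : t.col l ∈ Finset.range (μ.rowLen 0) := by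
    have h1 := t.col_lt_rowLen l
    have h3 := μ.rowLen_anti 0 (t.row l) (Nat.zero_le _)
    simp only [Finset.mem_range]
    omega
  have hsum : jucysMurphy F μ l (spechtPoly F t) = ∑ c ∈ Finset.range (μ.rowLen 0),
      ∑ x ∈ (Finset.univ.erase l).filter (fun x => t.col x = c),
        spechtPoly F (t.trans (swap l x)) := by
    rw [jucysMurphy_apply, Finset.sum_fiberwise_of_maps_to]
    · exact Finset.sum_congr rfl fun x _ => spechtRep_spechtPoly _ _
    · intro x _
      have h1 := t.col_lt_rowLen x
      have h3 := μ.rowLen_anti 0 (t.row x) (Nat.zero_le _)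
      simp only [Finset.mem_range]
      omega
  have hcont : (columnContent μ (μ.colLen (t.col l)) : F) • spechtPoly F t =
      ∑ c ∈ Finset.range (μ.rowLen 0),
        (((if μ.colLen (t.col l) ≤ μ.colLen c then 1 else 0) -
          (if c = t.col l then (μ.colLen (t.col l) : F) else 0) : F)) • spechtPoly F t := by
    rw [← Finset.sum_smul, Finset.sum_sub_distrib, Finset.sum_ite_eq' , if_pos hlr]
    unfold columnContent
    push_cast
    rfl
  rw [hsum, hcont, ← Finset.sum_sub_distrib]
  refine Submodule.sum_mem _ fun c _ => ?_
  by_cases hc : c = t.col l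
  · subst hc
    rw [if_pos le_rfl, if_pos rfl]
    have : ∑ x ∈ (Finset.univ.erase l).filter (fun x => t.col x = t.col l),
        spechtPoly F (t.trans (swap l x)) =
        ∑ x ∈ (Finset.univ.filter (fun x => t.col x = t.col l)).erase l, - spechtPoly F t := by
      rw [Finset.filter_erase]
      refine Finset.sum_congr rfl fun x hx => ?_
      simp only [Finset.mem_erase, Finset.mem_filter, Finset.mem_univ, true_and] at hx
      exact spechtPoly_trans_swap t hx.1.symm hx.2.symm
    rw [this, Finset.sum_const, Finset.card_erase_of_mem (by simp), t.card_col_filter]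
    have hpos : 1 ≤ μ.colLen (t.col l) := by
      have := t.row_lt_colLen l
      omega
    rw [← Nat.cast_smul_eq_nsmul F, Nat.cast_sub hpos]
    have : ((μ.colLen (t.col l) : F) - (1 : ℕ)) • -spechtPoly F t -
      ((1 : F) - (μ.colLen (t.col l) : F)) • spechtPoly F t = 0 := by
      push_cast
      module
    rw [this]
    exact zero_mem _
  · rw [if_neg hc, sub_zero]
    have hf : (Finset.univ.erase l).filter (fun x => t.col x = c) =
        Finset.univ.filter (fun x => t.col x = c) := by
      ext x
      simp only [Finset.mem_erase, Finset.mem_filter, Finset.mem_univ, true_and, and_true,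
        and_iff_right_iff_imp]
      rintro h rfl
      exact hc h.symm
    rw [hf]
    by_cases hlen : μ.colLen (t.col l) ≤ μ.colLen c
    · rw [if_pos hlen, ← spechtPoly_exchange h2 t hc hlen, one_smul, sub_self]
      exact zero_mem _
    · rw [if_neg hlen, zero_smul, sub_zero]
      refine Submodule.sum_mem _ fun x hx => Submodule.subset_span ⟨_, ?_, rfl⟩
      have hx' : t.col x = c := by simpa using hx
      change μ.colLen (Tableau.col (t.trans (swap l x)) l) < _
      rw [t.col_trans, swap_inv, swap_apply_left, hx']
      omega

/-- The rows below `k` that end in a removable node. -/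
def cornerRows (μ : YoungDiagram) (a k : ℕ) : Finset ℕ :=
  (Finset.Ico a k).filter fun i => μ.rowLen (i + 1) < μ.rowLen i

/-- Columns end only in rows with a removable node, so the other levels of the filtration add
nothing. -/
theorem colLen_ne_of_rowLen_eq {k c : ℕ} (h : ¬ μ.rowLen (k + 1) < μ.rowLen k) :
    μ.colLen c ≠ k + 1 := by
  intro hc
  have h1 : (k, c) ∈ μ := YoungDiagram.mem_iff_lt_colLen.2 (by omega)
  have h3 : (k + 1, c) ∉ μ := by
    rw [YoungDiagram.mem_iff_lt_colLen]
    omega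
  rw [YoungDiagram.mem_iff_lt_rowLen] at h1 h3
  omega

/-- Each new layer costs one linear factor, since the operator acts on it as a scalar modulo the
earlier layers. Roots may coincide in `F`; only the degree is used later. -/
theorem exists_monic_annihilating (h2 : (2 : F) ≠ 0) (l : Fin n) (k : ℕ) :
    ∃ q : Polynomial F, q.Monic ∧ q.natDegree = (cornerRows μ 0 k).card ∧
      ∀ t : Tableau μ n, μ.colLen (t.col l) ≤ k →
        Polynomial.aeval (jucysMurphy F μ l) q (spechtPoly F t) = 0 := by
  induction k with
  | zero =>
    refine ⟨1, Polynomial.monic_one, by simp [cornerRows], fun t ht => ?_⟩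
    have := t.row_lt_colLen l
    omega
  | succ k ih =>
    obtain ⟨q, hq, hdeg, hkill⟩ := ih
    have hIco : Finset.Ico 0 (k + 1) = insert k (Finset.Ico 0 k) := by
      ext x; simp only [Finset.mem_Ico, Finset.mem_insert]; omega
    by_cases hk : μ.rowLen (k + 1) < μ.rowLen k
    · refine ⟨q * (Polynomial.X - Polynomial.C (columnContent μ (k + 1) : F)),
        hq.mul (Polynomial.monic_X_sub_C _), ?_, fun t ht => ?_⟩
      · rw [hq.natDegree_mul (Polynomial.monic_X_sub_C _), hdeg, Polynomial.natDegree_X_sub_C]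
        unfold cornerRows
        rw [hIco, Finset.filter_insert, if_pos hk, Finset.card_insert_of_notMem (by simp)]
      · rcases Nat.le_or_eq_of_le_succ ht with ht | ht
        · rw [mul_comm, map_mul, Module.End.mul_apply, hkill t ht, map_zero]
        · rw [map_mul, Module.End.mul_apply]
          have h := jucysMurphy_spechtPoly h2 l t
          rw [ht] at h
          simp only [map_sub, Polynomial.aeval_X, Polynomial.aeval_C, LinearMap.sub_apply,
            Module.algebraMap_end_apply]
          have hle : Submodule.span F (spechtPoly F '' {s : Tableau μ n |
              μ.colLen (s.col l) < k + 1}) ≤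
              LinearMap.ker (Polynomial.aeval (jucysMurphy F μ l) q) := by
            rw [Submodule.span_le]
            rintro _ ⟨s, hs, rfl⟩
            exact hkill s (Nat.lt_succ_iff.1 hs)
          have := hle h
          rw [LinearMap.mem_ker, map_sub] at this
          exact this
    · refine ⟨q, hq, ?_, fun t ht => ?_⟩
      · unfold cornerRows
        rw [hIco, Finset.filter_insert, if_neg hk]
        exact hdeg
      · rcases Nat.le_or_eq_of_le_succ ht with ht | ht
        · exact hkill t ht
        · exact absurd ht (colLen_ne_of_rowLen_eq hk)

/-- The entries other than `l` whose value exceeds the length of their column. -/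
def excess (t : Tableau μ n) (l : Fin n) (T : Fin n → ℕ) : Finset (Fin n) :=
  Finset.univ.filter fun x => x ≠ l ∧ μ.colLen (t.col x) ≤ T x

theorem mem_excess {t : Tableau μ n} {l x : Fin n} {T : Fin n → ℕ} :
    x ∈ excess t l T ↔ x ≠ l ∧ μ.colLen (t.col x) ≤ T x := by
  simp [excess]

/-- The swap changes values only at `l`, which is never counted, and at `x`. -/
theorem excess_erase_subset (t : Tableau μ n) (l x : Fin n) (T : Fin n → ℕ) :
    (excess t l T).erase x ⊆ excess t l (T ∘ swap l x) := by
  intro y hy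
  rw [Finset.mem_erase, mem_excess] at hy
  rw [mem_excess, Function.comp_apply, swap_apply_of_ne_of_ne hy.2.1 hy.1]
  exact hy.2

theorem excess_subset (t : Tableau μ n) {l x : Fin n} {T : Fin n → ℕ} (hxl : x ≠ l)
    (hx : μ.colLen (t.col x) ≤ T x → μ.colLen (t.col x) ≤ T l) :
    excess t l T ⊆ excess t l (T ∘ swap l x) := by
  intro y hy
  by_cases hyx : y = x
  · subst hyx
    rw [mem_excess] at hy ⊢
    rw [Function.comp_apply, swap_apply_right]
    exact ⟨hxl, hx hy.2⟩
  · exact excess_erase_subset t l x T (Finset.mem_erase.2 ⟨hyx, hy⟩)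

theorem spechtCoeff_jucysMurphy_pow_succ (l : Fin n) (k : ℕ) (v : SpechtModule F μ n)
    (T : Fin n → ℕ) :
    spechtCoeff ((jucysMurphy F μ l ^ (k + 1)) v) T =
      ∑ x ∈ Finset.univ.erase l, spechtCoeff ((jucysMurphy F μ l ^ k) v) (T ∘ swap l x) := by
  rw [pow_succ', Module.End.mul_apply, jucysMurphy_apply, map_sum, Finset.sum_apply]
  exact Finset.sum_congr rfl fun x _ => spechtCoeff_rep _ _ _

/-- A polytabloid has zero coefficient where any excess remains, and each factor removes at most one
excess entry. -/
theorem spechtCoeff_jucysMurphy_pow_eq_zero (l : Fin n) (t : Tableau μ n) (k : ℕ)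
    (T : Fin n → ℕ) (h : k < (excess t l T).card) :
    spechtCoeff ((jucysMurphy F μ l ^ k) (spechtPoly F t)) T = 0 := by
  induction k generalizing T with
  | zero =>
    obtain ⟨x, hx⟩ := Finset.card_pos.1 h
    rw [mem_excess] at hx
    rw [pow_zero, Module.End.one_apply, spechtCoeff_spechtPoly]
    by_contra h0
    have := lt_colLen_of_tabloidCoeff_polytabloid_ne_zero h0 x
    omega
  | succ k ih =>
    rw [spechtCoeff_jucysMurphy_pow_succ]
    refine Finset.sum_eq_zero fun x _ => ih _ ?_
    have h1 := Finset.card_le_card (excess_erase_subset t l x T)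
    have h3 := Finset.pred_card_le_card_erase (s := excess t l T) (a := x)
    omega

/-- With only `k` factors, each must remove an excess entry `x`, so `T l` fits the column of `x`
while `T x` does not. The value at `l` therefore only grows, never fits the column of `z`, and `z`
stays in excess. -/
theorem spechtCoeff_jucysMurphy_pow_eq_zero_of_blocked (l : Fin n) (t : Tableau μ n) (k : ℕ)
    (T : Fin n → ℕ) (h : k ≤ (excess t l T).card) {z : Fin n} (hz : z ∈ excess t l T)
    (hl : μ.colLen (t.col z) ≤ T l) :
    spechtCoeff ((jucysMurphy F μ l ^ k) (spechtPoly F t)) T = 0 := by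
  induction k generalizing T with
  | zero => exact spechtCoeff_jucysMurphy_pow_eq_zero l t 0 T (Finset.card_pos.2 ⟨z, hz⟩)
  | succ k ih =>
    rw [spechtCoeff_jucysMurphy_pow_succ]
    refine Finset.sum_eq_zero fun x hx => ?_
    have hxl : x ≠ l := Finset.ne_of_mem_erase hx
    by_cases hblock : μ.colLen (t.col x) ≤ T x → μ.colLen (t.col x) ≤ T l
    · apply spechtCoeff_jucysMurphy_pow_eq_zero
      have := Finset.card_le_card (excess_subset t hxl hblock)
      omega
    · push Not at hblock
      have hzx : z ≠ x := by rintro rfl; omega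
      refine ih _ ?_ ?_ ?_
      · have h1 := Finset.card_le_card (excess_erase_subset t l x T)
        have h3 := Finset.pred_card_le_card_erase (s := excess t l T) (a := x)
        omega
      · exact excess_erase_subset t l x T (Finset.mem_erase.2 ⟨hzx, hz⟩)
      · rw [Function.comp_apply, swap_apply_left]
        omega

/-- Treating another excess entry first would give `l` a value too large for the column of `z` and
block it. Swapping with an entry not in excess wastes a factor. -/
theorem spechtCoeff_jucysMurphy_pow_succ_eq (l : Fin n) (t : Tableau μ n) (k : ℕ)
    (T : Fin n → ℕ) (h : k + 1 ≤ (excess t l T).card) {z : Fin n} (hz : z ∈ excess t l T)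
    (hmin : ∀ x ∈ excess t l T, x ≠ z → μ.colLen (t.col z) ≤ T x) :
    spechtCoeff ((jucysMurphy F μ l ^ (k + 1)) (spechtPoly F t)) T =
      spechtCoeff ((jucysMurphy F μ l ^ k) (spechtPoly F t)) (T ∘ swap l z) := by
  rw [spechtCoeff_jucysMurphy_pow_succ]
  apply Finset.sum_eq_single_of_mem z
  · exact Finset.mem_erase.2 ⟨(mem_excess.1 hz).1, Finset.mem_univ _⟩
  intro x hx hxz
  have hxl : x ≠ l := Finset.ne_of_mem_erase hx
  by_cases hxe : x ∈ excess t l T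
  · apply spechtCoeff_jucysMurphy_pow_eq_zero_of_blocked (z := z)
    · have h1 := Finset.card_le_card (excess_erase_subset t l x T)
      have h3 := Finset.pred_card_le_card_erase (s := excess t l T) (a := x)
      omega
    · exact excess_erase_subset t l x T (Finset.mem_erase.2 ⟨hxz.symm, hz⟩)
    · rw [Function.comp_apply, swap_apply_left]
      exact hmin x hxe hxz
  · apply spechtCoeff_jucysMurphy_pow_eq_zero
    have hx' : ¬ μ.colLen (t.col x) ≤ T x := fun h => hxe (mem_excess.2 ⟨hxl, h⟩)
    have := Finset.card_le_card (excess_subset t hxl fun h => absurd h hx')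
    omega

end JucysMurphy

/-! ### Endomorphisms of the restriction as polynomials in the Jucys–Murphy operator. -/

section Centralizer

variable {μ : YoungDiagram} {n : ℕ} {F : Type*} [Field F]

/-- The last row of the block of rows of the same length that contains row `a`. -/
def blockEnd (μ : YoungDiagram) (a : ℕ) : ℕ := μ.colLen (μ.rowLen a - 1) - 1

theorem colLen_rowLen_sub_one {a : ℕ} (h : 0 < μ.rowLen a) :
    a < μ.colLen (μ.rowLen a - 1) := by
  rw [← YoungDiagram.mem_iff_lt_colLen, YoungDiagram.mem_iff_lt_rowLen]
  omega

theorem le_blockEnd {a : ℕ} (h : 0 < μ.rowLen a) : a ≤ blockEnd μ a := by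
  have := colLen_rowLen_sub_one h
  unfold blockEnd
  omega

theorem blockEnd_succ {a : ℕ} (h : ¬ μ.rowLen (a + 1) < μ.rowLen a) :
    blockEnd μ (a + 1) = blockEnd μ a := by
  have := μ.rowLen_anti a (a + 1) (Nat.le_succ a)
  unfold blockEnd
  rw [show μ.rowLen (a + 1) = μ.rowLen a by omega]

theorem colLen_of_corner {a : ℕ} (h : μ.rowLen (a + 1) < μ.rowLen a) :
    μ.colLen (μ.rowLen a - 1) = a + 1 := by
  have h1 := colLen_rowLen_sub_one (μ := μ) (a := a) (by omega)
  have h3 : (a + 1, μ.rowLen a - 1) ∉ μ := by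
    rw [YoungDiagram.mem_iff_lt_rowLen]
    omega
  rw [YoungDiagram.mem_iff_lt_colLen] at h3
  omega

theorem blockEnd_of_corner {a : ℕ} (h : μ.rowLen (a + 1) < μ.rowLen a) : blockEnd μ a = a := by
  unfold blockEnd
  rw [colLen_of_corner h]
  rfl

/-- The row function of `t`, with the removable nodes between row `a` and the row of `l` permuted
cyclically. -/
def cornerCycle (t : Tableau μ n) (l : Fin n) (a : ℕ) (x : Fin n) : ℕ :=
  if x = l then blockEnd μ a
  else if t.row x < t.row l ∧ a ≤ t.row x ∧ t.IsRowEnd x ∧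
    μ.rowLen (t.row x + 1) < μ.rowLen (t.row x) then blockEnd μ (t.row x + 1)
  else t.row x

theorem Tableau.IsCorner.rowLen_lt {t : Tableau μ n} {x : Fin n} (h : t.IsCorner x) :
    μ.rowLen (t.row x + 1) < μ.rowLen (t.row x) := by
  have h1 : t.col x + 1 = _ := h.1
  have h3 := h.2
  omega

theorem Tableau.IsRowEnd.colLen_eq {t : Tableau μ n} {x : Fin n} (h : t.IsRowEnd x)
    (h' : μ.rowLen (t.row x + 1) < μ.rowLen (t.row x)) : μ.colLen (t.col x) = t.row x + 1 := by
  have h1 : t.col x + 1 = _ := h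
  rw [← colLen_of_corner h', ← h1, Nat.add_sub_cancel]

theorem cornerCycle_succ_of_not_corner (t : Tableau μ n) (l : Fin n) {a : ℕ}
    (h : ¬ μ.rowLen (a + 1) < μ.rowLen a) : cornerCycle t l a = cornerCycle t l (a + 1) := by
  ext x
  unfold cornerCycle
  rw [blockEnd_succ h]
  split_ifs with h1 h3 h4 h4
  · rfl
  · rfl
  · exfalso
    apply h4
    refine ⟨h3.1, ?_, h3.2.2⟩
    rcases Nat.eq_or_lt_of_le h3.2.1 with h5 | h5
    · exact absurd h3.2.2.2 (h5 ▸ h)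
    · exact h5
  · exact absurd ⟨h4.1, by omega, h4.2.2⟩ h3
  · rfl

/-- Among the removable nodes from row `a` on, the topmost has the shortest column, so the first
swap must exchange it with `l`. This shortens the cycle by one; the trivial cycle is `t.row`, with
coefficient 1. -/
theorem spechtCoeff_cornerCycle (t : Tableau μ n) {l : Fin n} (hl : t.IsCorner l) {a : ℕ}
    (ha : a ≤ t.row l) :
    spechtCoeff ((jucysMurphy F μ l ^ (cornerRows μ a (t.row l)).card) (spechtPoly F t))
      (cornerCycle t l a) = 1 := by
  induction ha using Nat.decreasingInduction with
  | self =>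
    have h1 : cornerRows μ (t.row l) (t.row l) = ∅ := by simp [cornerRows]
    have h3 : cornerCycle t l (t.row l) = t.row := by
      ext x
      unfold cornerCycle
      split_ifs with h4 h5
      · rw [h4, blockEnd_of_corner hl.rowLen_lt]
      · omega
      · rfl
    rw [h1, h3, Finset.card_empty, pow_zero, Module.End.one_apply, spechtCoeff_spechtPoly,
      tabloidCoeff_polytabloid_row]
  | of_succ a ha ih =>
    have hIco : Finset.Ico a (t.row l) = insert a (Finset.Ico (a + 1) (t.row l)) := by
      ext x; simp only [Finset.mem_Ico, Finset.mem_insert]; omega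
    by_cases hc : μ.rowLen (a + 1) < μ.rowLen a
    · have hcard : (cornerRows μ a (t.row l)).card =
          (cornerRows μ (a + 1) (t.row l)).card + 1 := by
        unfold cornerRows
        rw [hIco, Finset.filter_insert, if_pos hc, Finset.card_insert_of_notMem (by simp)]
      have hpos : ∀ i, i ≤ t.row l → 0 < μ.rowLen i := fun i hi => by
        have h1 := μ.rowLen_anti i (t.row l) hi
        have h3 := t.col_lt_rowLen l
        omega
      obtain ⟨z, hzr, hze⟩ := t.exists_isRowEnd l (u := a) (by omega)
      have hzl : z ≠ l := by rintro rfl; omega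
      have hzval : cornerCycle t l a z = blockEnd μ (a + 1) := by
        unfold cornerCycle
        rw [if_neg hzl, if_pos ⟨by omega, hzr.ge, hze, by rw [hzr]; exact hc⟩, hzr]
      have hzlen : μ.colLen (t.col z) = a + 1 := by
        rw [hze.colLen_eq (by rw [hzr]; exact hc), hzr]
      have hmem : ∀ x, t.row x < t.row l → a ≤ t.row x → t.IsRowEnd x →
          μ.rowLen (t.row x + 1) < μ.rowLen (t.row x) →
          x ∈ excess t l (cornerCycle t l a) := by
        intro x h1 h3 h4 h5
        have hxl : x ≠ l := by rintro rfl; omega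
        rw [mem_excess]
        refine ⟨hxl, ?_⟩
        unfold cornerCycle
        rw [if_neg hxl, if_pos ⟨h1, h3, h4, h5⟩, h4.colLen_eq h5]
        exact le_blockEnd (hpos _ (by omega))
      rw [hcard, spechtCoeff_jucysMurphy_pow_succ_eq (z := z)]
      · have hcyc : cornerCycle t l a ∘ swap l z = cornerCycle t l (a + 1) := by
          ext x
          rw [Function.comp_apply]
          rcases eq_or_ne x l with rfl | hxl
          · rw [swap_apply_left, hzval]
            simp [cornerCycle]
          rcases eq_or_ne x z with rfl | hxz
          · rw [swap_apply_right]
            unfold cornerCycle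
            rw [if_pos rfl, if_neg hxl, if_neg (by omega), blockEnd_of_corner hc, hzr]
          · rw [swap_apply_of_ne_of_ne hxl hxz]
            unfold cornerCycle
            rw [if_neg hxl, if_neg hxl]
            congr 1
            rw [eq_iff_iff]
            constructor
            · rintro ⟨h1, h3, h4⟩
              refine ⟨h1, ?_, h4⟩
              by_contra h5
              exact hxz (h4.1.eq hze (by omega))
            · rintro ⟨h1, h3, h4⟩
              exact ⟨h1, by omega, h4⟩
        rw [hcyc, ih]
      · rw [← hcard]
        apply Finset.card_le_card_of_surjOn t.row
        intro i hi
        simp only [cornerRows, Finset.coe_filter, Finset.mem_Ico, Set.mem_ofPred_eq] at hi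
        obtain ⟨x, hxr, hxe⟩ := t.exists_isRowEnd l (u := i) (by omega)
        exact ⟨x, hmem x (by omega) (by omega) hxe (by rw [hxr]; exact hi.2), hxr⟩
      · exact hmem z (by omega) hzr.ge hze (by rw [hzr]; exact hc)
      · intro x hx hxz
        rw [mem_excess] at hx
        obtain ⟨hxl, hx⟩ := hx
        have h1 := t.row_lt_colLen x
        unfold cornerCycle at hx ⊢
        rw [if_neg hxl] at hx ⊢
        split_ifs at hx ⊢ with h3
        · rw [hzlen]
          exact (le_blockEnd (hpos _ (by omega))).trans' (by omega)
        · omega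
    · have hcard : cornerRows μ a (t.row l) = cornerRows μ (a + 1) (t.row l) := by
        unfold cornerRows
        rw [hIco, Finset.filter_insert, if_neg hc]
      rw [hcard, cornerCycle_succ_of_not_corner t l hc]
      exact ih

/-- The full cycle has at least as many excess entries as the degree of `q`, so only the leading
power contributes. -/
theorem spechtCoeff_aeval_cornerCycle (t : Tableau μ n) {l : Fin n} (hl : t.IsCorner l)
    {q : Polynomial F} (hq : q.Monic) (hdeg : q.natDegree = (cornerRows μ 0 (t.row l)).card) :
    spechtCoeff (Polynomial.aeval (jucysMurphy F μ l) q (spechtPoly F t)) (cornerCycle t l 0) =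
      1 := by
  have hle : (cornerRows μ 0 (t.row l)).card ≤ (excess t l (cornerCycle t l 0)).card := by
    apply Finset.card_le_card_of_surjOn t.row
    intro i hi
    simp only [cornerRows, Finset.coe_filter, Finset.mem_Ico, Set.mem_ofPred_eq] at hi
    obtain ⟨x, hxr, hxe⟩ := t.exists_isRowEnd l (u := i) (by omega)
    refine ⟨x, ?_, hxr⟩
    have hxl : x ≠ l := by rintro rfl; omega
    have hxc : μ.rowLen (t.row x + 1) < μ.rowLen (t.row x) := by rw [hxr]; exact hi.2
    rw [Finset.mem_coe, mem_excess]
    refine ⟨hxl, ?_⟩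
    unfold cornerCycle
    rw [if_neg hxl, if_pos ⟨by omega, Nat.zero_le _, hxe, hxc⟩, hxe.colLen_eq hxc]
    apply le_blockEnd
    have h1 := μ.rowLen_anti (t.row x + 1) (t.row l) (by omega)
    have h3 := t.col_lt_rowLen l
    omega
  rw [Polynomial.aeval_eq_sum_range, LinearMap.sum_apply, map_sum, Finset.sum_apply,
    Finset.sum_range_succ, Finset.sum_eq_zero, zero_add, LinearMap.smul_apply, map_smul,
    Pi.smul_apply, hq.coeff_natDegree, hdeg, spechtCoeff_cornerCycle t hl (Nat.zero_le _), one_smul]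
  intro k hk
  rw [LinearMap.smul_apply, map_smul, Pi.smul_apply, spechtCoeff_jucysMurphy_pow_eq_zero, smul_zero]
  rw [Finset.mem_range] at hk
  omega

/-- A map that commutes with the stabilizer of `l` and kills the polytabloids with `l` in a column
shorter than that of the corner occupied by `l` in `t` is determined on the polytabloid of `t` by
one coefficient. -/
theorem spechtCoeff_shiftedRow_ne_zero (h2 : (2 : F) ≠ 0) {l : Fin n} (t : Tableau μ n)
    (hl : t.IsCorner l) (f : SpechtModule F μ n →ₗ[F] SpechtModule F μ n)
    (hf : ∀ σ : Perm (Fin n), σ l = l → ∀ v, f (spechtRep F μ n σ v) = spechtRep F μ n σ (f v))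
    (hkill : ∀ s : Tableau μ n, μ.colLen (s.col l) < μ.colLen (t.col l) →
      f (spechtPoly F s) = 0)
    (hne : f (spechtPoly F t) ≠ 0) :
    spechtCoeff (f (spechtPoly F t)) (t.shiftedRow l) ≠ 0 := by
  obtain ⟨T, hT⟩ : ∃ T, spechtCoeff (f (spechtPoly F t)) T ≠ 0 := by
    by_contra h
    push Not at h
    exact hne (spechtCoeff_ext fun T => by rw [h T, map_zero]; rfl)
  have hlen : μ.colLen (t.col l) = t.row l + 1 := hl.1.colLen_eq hl.rowLen_lt
  refine shiftedRow_ne_zero h2 t l hl (spechtCoeff (f (spechtPoly F t))) ?_ ?_ ?_ ?_ T hT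
  · intro x y hx hy hxy hc T
    rw [← spechtCoeff_rep, ← hf _ (swap_apply_of_ne_of_ne hx.symm hy.symm), spechtRep_spechtPoly,
      spechtPoly_trans_swap t hxy hc, map_neg, map_neg]
    rfl
  · intro T hT i
    exact card_fiber_of_spechtCoeff_ne_zero hT i
  · intro T x j hj
    exact spechtCoeff_move h2 _ T hj
  · intro y c hy hyc T
    have hanti := μ.colLen_anti c (c + 1) (Nat.le_succ c)
    -- In the exchange relation, the term with `z = l` moves `l` into column `c + 1`. When `l` sits
    -- in column `c`, that column is shorter since `l` is a corner, so `f` kills this term.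
    have key : f (spechtPoly F t) = ∑ z ∈ Finset.univ.filter (fun z => z ≠ l ∧ t.col z = c),
        spechtRep F μ n (swap y z) (f (spechtPoly F t)) := by
      conv_lhs => rw [spechtPoly_exchange h2 t (c := c) (y := y) (by omega)
        (by rw [hyc]; exact hanti), map_sum]
      rw [← Finset.sum_filter_add_sum_filter_not _ (fun z => z ≠ l), Finset.filter_filter,
        Finset.filter_filter]
      rw [Finset.sum_eq_zero (s := Finset.univ.filter fun z => t.col z = c ∧ ¬ z ≠ l), add_zero]
      · refine Finset.sum_congr (by ext; simp [and_comm]) fun z hz => ?_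
        simp only [Finset.mem_filter, Finset.mem_univ, true_and] at hz
        rw [← hf _ (swap_apply_of_ne_of_ne hy.symm hz.1.symm), spechtRep_spechtPoly]
      · intro z hz
        simp only [Finset.mem_filter, Finset.mem_univ, true_and, not_not] at hz
        obtain ⟨hzc, rfl⟩ := hz
        apply hkill
        rw [t.col_trans, swap_inv, swap_apply_right, hyc, hlen]
        have h1 : ¬ (t.row z, c + 1) ∈ μ := by
          rw [YoungDiagram.mem_iff_lt_rowLen]
          have : t.col z + 1 = _ := hl.1
          omega
        rw [YoungDiagram.mem_iff_lt_colLen] at h1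
        omega
    conv_lhs => rw [key, map_sum, Finset.sum_apply]
    exact Finset.sum_congr rfl fun z _ => spechtCoeff_rep _ _ _

/-- Every endomorphism of the restriction of a Specht module to the stabilizer of `l` is a
polynomial in the Jucys–Murphy operator, in characteristic not two. -/
theorem exists_eq_aeval_jucysMurphy (h2 : (2 : F) ≠ 0) (hμ : μ.card = n) (l : Fin n)
    (f : SpechtModule F μ n →ₗ[F] SpechtModule F μ n)
    (hf : ∀ σ : Perm (Fin n), σ l = l → ∀ v, f (spechtRep F μ n σ v) = spechtRep F μ n σ (f v)) :
    ∃ p : Polynomial F, f = Polynomial.aeval (jucysMurphy F μ l) p := by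
  -- Induction over the layers: at a corner row, the polynomial is corrected by a multiple of the
  -- monic `q` that kills the previous layers.
  have step : ∀ k, ∃ p : Polynomial F, ∀ t : Tableau μ n, μ.colLen (t.col l) ≤ k →
      f (spechtPoly F t) = Polynomial.aeval (jucysMurphy F μ l) p (spechtPoly F t) := by
    intro k
    induction k with
    | zero =>
      refine ⟨0, fun t ht => ?_⟩
      have := t.row_lt_colLen l
      omega
    | succ k ih =>
      obtain ⟨p, hp⟩ := ih
      by_cases hk : μ.rowLen (k + 1) < μ.rowLen k
      swap
      · refine ⟨p, fun t ht => ?_⟩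
        rcases Nat.le_or_eq_of_le_succ ht with ht | ht
        · exact hp t ht
        · exact absurd ht (colLen_ne_of_rowLen_eq hk)
      obtain ⟨q, hq, hdeg, hkill⟩ := exists_monic_annihilating (μ := μ) h2 l k
      obtain ⟨t, htr, htc⟩ : ∃ t : Tableau μ n, t.row l = k ∧ t.col l = μ.rowLen k - 1 := by
        have hcell : (k, μ.rowLen k - 1) ∈ μ.cells := by
          rw [YoungDiagram.mem_cells, YoungDiagram.mem_iff_lt_rowLen]
          omega
        let e : Tableau μ n := μ.cells.equivFinOfCardEq hμ
        refine ⟨e.trans (swap (e ⟨_, hcell⟩) l), ?_, ?_⟩ <;>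
        simp [Tableau.row, Tableau.col]
      have hl : t.IsCorner l := by
        refine ⟨?_, by rw [htr, htc]; omega⟩
        change t.col l + 1 = _
        rw [htr, htc]
        omega
      have hlen : μ.colLen (t.col l) = k + 1 := by
        rw [hl.1.colLen_eq hl.rowLen_lt, htr]
      set v := Polynomial.aeval (jucysMurphy F μ l) q (spechtPoly F t) with hv
      have hv0 : v ≠ 0 := by
        intro h0
        have h1 := spechtCoeff_aeval_cornerCycle t hl hq (by rw [hdeg, htr])
        rw [← hv, h0, map_zero] at h1
        exact zero_ne_one h1
      have hv1 : spechtCoeff v (t.shiftedRow l) ≠ 0 := by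
        refine spechtCoeff_shiftedRow_ne_zero h2 t hl (Polynomial.aeval (jucysMurphy F μ l) q)
          (fun σ hσ w => aeval_jucysMurphy_spechtRep hσ q w) (fun s hs => hkill s ?_) hv0
        omega
      set w := f (spechtPoly F t) - Polynomial.aeval (jucysMurphy F μ l) p (spechtPoly F t) with hw
      -- This ratio makes the coefficient of `g` at the shifted row function zero, which forces `g`
      -- to kill the polytabloid of `t`.
      set a := spechtCoeff w (t.shiftedRow l) / spechtCoeff v (t.shiftedRow l) with ha
      set g : SpechtModule F μ n →ₗ[F] SpechtModule F μ n :=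
        f - Polynomial.aeval (jucysMurphy F μ l) (p + Polynomial.C a * q) with hg
      have hgapp : ∀ u, g u = f u - Polynomial.aeval (jucysMurphy F μ l) p u -
          a • Polynomial.aeval (jucysMurphy F μ l) q u := by
        intro u
        rw [hg, LinearMap.sub_apply, map_add, map_mul, Polynomial.aeval_C, LinearMap.add_apply,
          Module.End.mul_apply, Module.algebraMap_end_apply, sub_add_eq_sub_sub]
      have hgcomm : ∀ σ : Perm (Fin n), σ l = l →
          ∀ u, g (spechtRep F μ n σ u) = spechtRep F μ n σ (g u) := by
        intro σ hσ u
        rw [hg, LinearMap.sub_apply, LinearMap.sub_apply, map_sub, hf σ hσ,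
          aeval_jucysMurphy_spechtRep hσ]
      have hgkill : ∀ s : Tableau μ n, μ.colLen (s.col l) ≤ k → g (spechtPoly F s) = 0 := by
        intro s hs
        rw [hgapp, hp s hs, hkill s hs, sub_self, smul_zero, sub_zero]
      have hgt : g (spechtPoly F t) = 0 := by
        by_contra hne
        refine spechtCoeff_shiftedRow_ne_zero h2 t hl g hgcomm
          (fun s hs => hgkill s (by omega)) hne ?_
        rw [hgapp, ← hw, ← hv, map_sub, map_smul, Pi.sub_apply, Pi.smul_apply, smul_eq_mul, ha,
          div_mul_cancel₀ _ hv1, sub_self]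
      -- Tableaux with `l` at the same node differ by a permutation fixing `l`. Antisymmetry then
      -- covers the rest of that column, and the exchange relation covers other columns of the same
      -- length.
      have hg1 : ∀ s : Tableau μ n, s.row l = k → s.col l = μ.rowLen k - 1 →
          g (spechtPoly F s) = 0 := by
        intro s hsr hsc
        have hs : s = t.trans (t.symm.trans s) := by ext; simp
        have hfix : (t.symm.trans s) l = l := by
          have : t.symm l = s.symm l :=
            Subtype.ext (Prod.ext (htr.trans hsr.symm) (htc.trans hsc.symm))
          simp [this]
        rw [hs, ← spechtRep_spechtPoly, hgcomm _ hfix, hgt, map_zero]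
      have hg3 : ∀ s : Tableau μ n, s.col l = μ.rowLen k - 1 → g (spechtPoly F s) = 0 := by
        intro s hsc
        obtain ⟨z, hzr, hzc⟩ := s.exists_entry (i := k) (j := μ.rowLen k - 1)
          (YoungDiagram.mem_iff_lt_rowLen.2 (by omega))
        by_cases hzl : z = l
        · exact hg1 s (hzl ▸ hzr) hsc
        · have h1 := hg1 (s.trans (swap l z))
            (by rw [s.row_trans, swap_inv, swap_apply_left, hzr])
            (by rw [s.col_trans, swap_inv, swap_apply_left, hzc])
          rw [spechtPoly_trans_swap s (Ne.symm hzl) (hsc.trans hzc.symm), map_neg] at h1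
          exact neg_eq_zero.1 h1
      refine ⟨p + Polynomial.C a * q, fun s hs => ?_⟩
      rw [← sub_eq_zero, ← LinearMap.sub_apply, ← hg]
      rcases Nat.le_or_eq_of_le_succ hs with hs | hs
      · exact hgkill s hs
      by_cases hsc : s.col l = μ.rowLen k - 1
      · exact hg3 s hsc
      · rw [spechtPoly_exchange h2 s (c := μ.rowLen k - 1) (y := l) (Ne.symm hsc)
          (by rw [← htc, hlen]; exact hs.le), map_sum]
        refine Finset.sum_eq_zero fun z hz => hg3 _ ?_
        rw [s.col_trans, swap_inv, swap_apply_left]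
        simpa using hz
  obtain ⟨p, hp⟩ := step (μ.colLen 0)
  exact ⟨p, spechtModule_hom_ext fun t => hp t (μ.colLen_anti 0 _ (Nat.zero_le _))⟩

end Centralizer

/-! ### Block idempotents, indecomposability and the restricted module. -/

section Blocks

variable {μ : YoungDiagram} {n : ℕ} {F : Type*} [Field F]

/-- The powers of `a` stabilize up to multiples, so `a ^ (k + 1) * y = a ^ k` for some `y`, and `a ^
(k + 1) * y ^ (k + 1)` is the idempotent of the Fitting decomposition of `a`. -/
theorem exists_idempotent_of_isArtinianRing {R : Type*} [CommRing R] [IsArtinianRing R] {a b : R}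
    (hbb : b * b = b) (hab : b * a = a) :
    ∃ e y : R, ∃ k : ℕ, e * e = e ∧ (b - e) * (b - e) = b - e ∧ e * (b - e) = 0 ∧
      a ^ (k + 1) = a ^ (k + 1) * e ∧ e = y * a := by
  obtain ⟨k, y, hy⟩ := IsArtinian.exists_pow_succ_smul_dvd a (1 : R)
  rw [smul_eq_mul, smul_eq_mul, mul_one, Nat.succ_eq_add_one] at hy
  have hpow : ∀ j, a ^ (k + 1 + j) * y ^ j = a ^ (k + 1) := by
    intro j
    induction j with
    | zero => simp
    | succ j ih =>
      calc a ^ (k + 1 + (j + 1)) * y ^ (j + 1)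
          = (a ^ (k + 1) * y) * a * (a ^ j * y ^ j) := by ring
        _ = a ^ (k + 1 + j) * y ^ j := by rw [hy]; ring
        _ = _ := ih
  obtain ⟨e, he⟩ : ∃ e, e = a ^ (k + 1) * y ^ (k + 1) := ⟨_, rfl⟩
  have hee : e * e = e := by
    calc e * e = (a ^ (k + 1 + (k + 1)) * y ^ (k + 1)) * y ^ (k + 1) := by rw [he]; ring
      _ = e := by rw [hpow, he]
  have hbe : b * e = e := by
    calc b * e = (b * a) * a ^ k * y ^ (k + 1) := by rw [he]; ring
      _ = e := by rw [hab, he]; ring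
  refine ⟨e, a ^ k * y ^ (k + 1), k, hee, ?_, ?_, ?_, ?_⟩
  · linear_combination hbb - 2 * hbe + hee
  · linear_combination hbe - hee
  · rw [← hpow (k + 1), he, pow_add]
    linear_combination (- a ^ (k + 1) * y ^ (k + 1)) * hpow (k + 1)
  · rw [he]; ring

/-- Central elements in the ideal of a block idempotent are nilpotent or invertible there. -/
theorem IsBlockIdempotent.nilpotent_or_invertible {A : Type*} [Ring A] [Algebra F A]
    [Module.Finite F A] {b : A} (hb : IsBlockIdempotent b) {a : A} (ha : a ∈ Subring.center A)
    (hab : b * a = a) : (∃ m, a ^ (m + 1) = 0) ∨ ∃ y, y * a = b := by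
  have hmem : ∀ x : A, x ∈ Subring.center A ↔ x ∈ Subalgebra.center F A := fun x => by
    rw [Subring.mem_center_iff, Subalgebra.mem_center_iff]
  have : IsArtinianRing (Subalgebra.center F A) := IsArtinianRing.of_finite F _
  obtain ⟨e, y, k, hee, hf, hef, hpow, hy⟩ := exists_idempotent_of_isArtinianRing
    (a := (⟨a, (hmem a).1 ha⟩ : Subalgebra.center F A))
    (b := ⟨b, (hmem b).1 hb.mem_center⟩) (Subtype.ext hb.idem) (Subtype.ext hab)
  have hee' : (e : A) * e = e := congrArg Subtype.val hee
  have hf' : (b - e) * (b - e : A) = b - e := congrArg Subtype.val hf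
  have hef' : (e : A) * (b - e) = 0 := congrArg Subtype.val hef
  have hpow' : a ^ (k + 1) = a ^ (k + 1) * e := congrArg Subtype.val hpow
  have hy' : (e : A) = y * a := congrArg Subtype.val hy
  have he := (hmem _).2 e.2
  -- Primitivity leaves two cases: `e = 0` makes `a` nilpotent, and `e = b` makes it invertible in
  -- the ideal of `b`.
  rcases hb.primitive e (b - e) he (sub_mem hb.mem_center he) hee' hf' hef' (by simp) with h | h
  · exact Or.inl ⟨k, by rw [hpow', h, mul_zero]⟩
  · exact Or.inr ⟨y, by rw [← hy', sub_eq_zero.1 h]⟩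

/-- If every endomorphism of a module is the action of a central element, then its block
components are zero or indecomposable. -/
theorem blockPart_eq_bot_or_indecomposable (F : Type*) [Field F] {A : Type*} [Ring A] [Algebra F A]
    [Module.Finite F A] {b : A} (hb : IsBlockIdempotent b) (M : Type*) [AddCommGroup M] [Module A M]
    (h : ∀ φ : M →ₗ[A] M, ∃ z ∈ Subring.center A, ∀ m, φ m = z • m) :
    blockPart b hb.mem_center M = ⊥ ∨
      IsIndecomposableModule A (blockPart b hb.mem_center M) := by
  by_cases hbot : blockPart b hb.mem_center M = ⊥
  · exact Or.inl hbot
  right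
  refine ⟨Submodule.nontrivial_iff_ne_bot.2 hbot, fun N N' hN => ?_⟩
  have hcomm := Subring.mem_center_iff.1 hb.mem_center
  have hbx : ∀ x : blockPart b hb.mem_center M, b • x = x := by
    rintro ⟨_, m, rfl⟩
    apply Subtype.ext
    change b • b • m = b • m
    rw [smul_smul, hb.idem]
  let π : M →ₗ[A] blockPart b hb.mem_center M :=
    { toFun := fun m => ⟨b • m, m, rfl⟩
      map_add' := fun x y => Subtype.ext (smul_add b x y)
      map_smul' := fun a x => Subtype.ext (by
        change b • a • x = a • b • x
        rw [smul_smul, smul_smul, hcomm a]) }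
  have hπ : ∀ x : blockPart b hb.mem_center M, π x = x := fun x => by
    conv_rhs => rw [← hbx x]
    rfl
  -- The projection onto `N` becomes an endomorphism of all of `M` by first multiplying by `b`.
  obtain ⟨z, hz, hzφ⟩ := h ((blockPart b hb.mem_center M).subtype ∘ₗ N.projection N' hN ∘ₗ π)
  have hP : ∀ x : blockPart b hb.mem_center M, N.projection N' hN x = z • x := by
    intro x
    apply Subtype.ext
    have := hzφ x
    rwa [LinearMap.comp_apply, LinearMap.comp_apply, hπ] at this
  have hPa : ∀ x : blockPart b hb.mem_center M, N.projection N' hN x = (b * z) • x := by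
    intro x
    rw [mul_smul, ← hP, hbx]
  -- The element `b * z` fixes `N` and kills `N'`: if nilpotent it forces `N = ⊥`, if invertible `N'
  -- = ⊥`.
  rcases hb.nilpotent_or_invertible (F := F) (a := b * z) (mul_mem hb.mem_center hz)
    (by rw [← mul_assoc, hb.idem]) with ⟨m, hm⟩ | ⟨y, hy⟩
  · left
    rw [Submodule.eq_bot_iff]
    intro x hx
    have hPx : (b * z) • x = x := by
      rw [← hPa, Submodule.projection_apply_of_mem_left hN hx]
    have hpow : ∀ k, (b * z) ^ k • x = x := by
      intro k
      induction k with
      | zero => simp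
      | succ k ih => rw [pow_succ, mul_smul, hPx, ih]
    rw [← hpow (m + 1), hm, zero_smul]
  · right
    rw [Submodule.eq_bot_iff]
    intro x hx
    have hPx : (b * z) • x = 0 := by
      rw [← hPa, Submodule.projection_apply_of_mem_right hN hx]
    have hyx : b • x = (y * (b * z)) • x := by rw [hy]
    rw [← hbx x, hyx, mul_smul, hPx, smul_zero]

theorem blockPart_asModule_eq_bot_or_indecomposable {G V : Type*} [Group G] [Finite G]
    [AddCommGroup V] [Module F V] (ρ : Representation F G V) {b : MonoidAlgebra F G}
    (hb : IsBlockIdempotent b)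
    (h : ∀ f : V →ₗ[F] V, (∀ g v, f (ρ g v) = ρ g (f v)) →
      ∃ z ∈ Subring.center (MonoidAlgebra F G), f = ρ.asAlgebraHom z) :
    blockPart b hb.mem_center ρ.asModule = ⊥ ∨
      IsIndecomposableModule (MonoidAlgebra F G) (blockPart b hb.mem_center ρ.asModule) := by
  have : Module.Finite F (MonoidAlgebra F G) :=
    Module.Finite.equiv (MonoidAlgebra.coeffLinearEquiv F).symm
  apply blockPart_eq_bot_or_indecomposable F hb
  intro φ
  have hφ : ∀ (r : F) (g : G) (v : V), φ (ρ.asModuleEquiv.symm (r • ρ g v)) =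
      ρ.asModuleEquiv.symm (r • ρ g (ρ.asModuleEquiv (φ (ρ.asModuleEquiv.symm v)))) := by
    intro r g v
    have h1 := φ.map_smul (MonoidAlgebra.single g r) (ρ.asModuleEquiv.symm v)
    rw [Representation.single_smul, Representation.single_smul] at h1
    exact h1
  let f : V →ₗ[F] V :=
    { toFun := fun v => ρ.asModuleEquiv (φ (ρ.asModuleEquiv.symm v))
      map_add' := fun x y => by simp
      map_smul' := fun r v => by
        have h1 := hφ r 1 v
        rw [map_one, Module.End.one_apply, Module.End.one_apply] at h1
        rw [h1]
        simp }
  obtain ⟨z, hz, hfz⟩ := h f (fun g v => by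
    have h1 := hφ 1 g v
    rw [one_smul, one_smul] at h1
    change ρ.asModuleEquiv (φ (ρ.asModuleEquiv.symm _)) = _
    rw [h1]
    rfl)
  refine ⟨z, hz, fun m => ?_⟩
  apply ρ.asModuleEquiv.injective
  rw [Representation.asModuleEquiv_map_smul, ← hfz]
  rfl

/-! ### The embedding of symmetric groups and sums of transpositions -/

theorem symEmb_castSucc (σ : Perm (Fin n)) (x : Fin n) :
    symEmb n σ x.castSucc = (σ x).castSucc :=
  Perm.viaEmbedding_apply σ Fin.castSuccEmb x

theorem symEmb_last (σ : Perm (Fin n)) : symEmb n σ (Fin.last n) = Fin.last n := by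
  apply Perm.viaEmbedding_apply_of_notMem
  rintro ⟨x, hx⟩
  exact (Fin.castSucc_lt_last x).ne hx

theorem symEmb_swap (x y : Fin n) : symEmb n (swap x y) = swap x.castSucc y.castSucc := by
  ext z : 1
  induction z using Fin.lastCases with
  | last =>
    rw [symEmb_last, swap_apply_of_ne_of_ne (Fin.castSucc_lt_last x).ne'
      (Fin.castSucc_lt_last y).ne']
  | cast z =>
    rw [symEmb_castSucc, swap_apply_def, swap_apply_def]
    simp only [Fin.castSucc_inj]
    split_ifs <;> rfl

theorem exists_symEmb_eq {σ : Perm (Fin (n + 1))} (h : σ (Fin.last n) = Fin.last n) :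
    ∃ τ, symEmb n τ = σ := by
  have key : ∀ σ : Perm (Fin (n + 1)), σ (Fin.last n) = Fin.last n → ∀ x : Fin n,
      σ x.castSucc ≠ Fin.last n := fun σ hσ x hx =>
    (Fin.castSucc_lt_last x).ne (σ.injective (hx.trans hσ.symm))
  have h' : σ⁻¹ (Fin.last n) = Fin.last n := by
    rw [Perm.inv_eq_iff_eq, h]
  refine ⟨⟨fun x => (σ x.castSucc).castPred (key σ h x),
    fun x => (σ⁻¹ x.castSucc).castPred (key σ⁻¹ h' x), fun x => ?_, fun x => ?_⟩, ?_⟩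
  · simp
  · simp
  · ext z : 1
    induction z using Fin.lastCases with
    | last => rw [symEmb_last, h]
    | cast z => rw [symEmb_castSucc]; simp

variable (F) in
/-- Twice the sum of all transpositions plus a scalar, as an element of the group algebra. -/
def swapSum (n : ℕ) : MonoidAlgebra F (Perm (Fin n)) :=
  ∑ x, ∑ y, MonoidAlgebra.single (swap x y) 1

theorem mem_center_of_commute_single {G : Type*} [Group G] {z : MonoidAlgebra F G}
    (h : ∀ g : G, Commute z (MonoidAlgebra.single g 1)) :
    z ∈ Subring.center (MonoidAlgebra F G) := by
  rw [Subring.mem_center_iff]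
  intro w
  induction w using MonoidAlgebra.induction_on with
  | of g => exact (h g).symm
  | add a b ha hb => rw [add_mul, mul_add, ha, hb]
  | smul r a ha => rw [smul_mul_assoc, ha, mul_smul_comm]

theorem commute_swapSum (g : Perm (Fin n)) :
    Commute (swapSum F n) (MonoidAlgebra.single g 1) := by
  change _ * _ = _ * _
  unfold swapSum
  simp only [Finset.sum_mul, Finset.mul_sum, MonoidAlgebra.single_mul_single, one_mul]
  rw [← Equiv.sum_comp g]
  refine Finset.sum_congr rfl fun x _ => ?_
  rw [← Equiv.sum_comp g]
  refine Finset.sum_congr rfl fun y _ => ?_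
  rw [swap_apply_apply]
  simp

theorem asAlgebraHom_swapSum {V : Type*} [AddCommGroup V] [Module F V]
    (ρ : Representation F (Perm (Fin n)) V) (v : V) :
    ρ.asAlgebraHom (swapSum F n) v = ∑ x, ∑ y, ρ (swap x y) v := by
  simp [swapSum]

theorem asAlgebraHom_swapSum_commute {V : Type*} [AddCommGroup V] [Module F V]
    (ρ : Representation F (Perm (Fin n)) V) (σ : Perm (Fin n)) :
    Commute (ρ.asAlgebraHom (swapSum F n)) (ρ σ) := by
  have h := (commute_swapSum (F := F) σ).map ρ.asAlgebraHom
  rwa [Representation.asAlgebraHom_single_one] at h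

/-- Ordered pairs avoiding the last letter give the smaller sum, pairs containing it once occur
twice, and the diagonal pair gives the identity. -/
theorem asAlgebraHom_swapSum_succ {V : Type*} [AddCommGroup V] [Module F V]
    (ρ : Representation F (Perm (Fin (n + 1))) V) (v : V) :
    ρ.asAlgebraHom (swapSum F (n + 1)) v = (restrictRep F ρ).asAlgebraHom (swapSum F n) v +
      (2 : F) • ∑ x : Fin n, ρ (swap (Fin.last n) x.castSucc) v + v := by
  rw [asAlgebraHom_swapSum, asAlgebraHom_swapSum, Fin.sum_univ_castSucc]
  simp only [Fin.sum_univ_castSucc]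
  rw [Finset.sum_add_distrib, swap_self]
  have h1 : ∀ x y : Fin n, restrictRep F ρ (swap x y) v =
      ρ (swap x.castSucc y.castSucc) v := fun x y => by
    rw [← symEmb_swap]; rfl
  have h3 : ρ (Equiv.refl _) v = v := by
    change ρ 1 v = v
    rw [map_one]; rfl
  simp only [h1, h3, swap_comm _ (Fin.last n), two_smul]
  abel

theorem jucysMurphy_last_apply (v : SpechtModule F μ (n + 1)) :
    jucysMurphy F μ (Fin.last n) v =
      ∑ x : Fin n, spechtRep F μ (n + 1) (swap (Fin.last n) x.castSucc) v := by
  have herase : Finset.univ.erase (Fin.last n) = Finset.univ.map Fin.castSuccEmb := by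
    ext x
    induction x using Fin.lastCases with
    | last => simp
    | cast x => simp [(Fin.castSucc_lt_last x).ne]
  rw [jucysMurphy_apply, herase, Finset.sum_map]
  rfl

/-- A central element acts as an endomorphism, and these are scalars. -/
theorem exists_asAlgebraHom_swapSum_eq_smul (h2 : (2 : F) ≠ 0) (μ : YoungDiagram) (n : ℕ) :
    ∃ a : F, ∀ v, (spechtRep F μ n).asAlgebraHom (swapSum F n) v = a • v :=
  exists_eq_smul_of_commute h2 _ fun σ v =>
    LinearMap.congr_fun (asAlgebraHom_swapSum_commute (spechtRep F μ n) σ) v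

/-- The central element of the smaller group algebra that acts as the Jucys–Murphy operator. -/
theorem exists_central_eq_jucysMurphy (h2 : (2 : F) ≠ 0) (μ : YoungDiagram) (n : ℕ) :
    ∃ w : MonoidAlgebra F (Perm (Fin n)), (∀ g, Commute w (MonoidAlgebra.single g 1)) ∧
      (restrictRep F (spechtRep F μ (n + 1))).asAlgebraHom w = jucysMurphy F μ (Fin.last n) := by
  obtain ⟨a, ha⟩ := exists_asAlgebraHom_swapSum_eq_smul h2 μ (n + 1)
  -- With Z the smaller sum, this solves a = Z + 2L + 1 for L.
  refine ⟨algebraMap F _ ((a - 1) / 2) - (1 / 2 : F) • swapSum F n, fun g => ?_, ?_⟩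
  · apply Commute.sub_left
    · exact Algebra.commutes _ _
    · exact (commute_swapSum g).smul_left _
  · ext v : 1
    have h := asAlgebraHom_swapSum_succ (spechtRep F μ (n + 1)) v
    rw [ha, ← jucysMurphy_last_apply] at h
    rw [map_sub, map_smul, AlgHom.commutes, LinearMap.sub_apply, LinearMap.smul_apply,
      Module.algebraMap_end_apply]
    have h3 : (restrictRep F (spechtRep F μ (n + 1))).asAlgebraHom (swapSum F n) v =
        a • v - (2 : F) • jucysMurphy F μ (Fin.last n) v - v := by
      rw [h]; abel
    rw [h3]
    match_scalars
    · field_simp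
      ring
    · field_simp

theorem exists_eq_aeval_of_commute_restrictRep (h2 : (2 : F) ≠ 0) (hμ : μ.card = n + 1)
    (f : SpechtModule F μ (n + 1) →ₗ[F] SpechtModule F μ (n + 1))
    (hf : ∀ g v, f (restrictRep F (spechtRep F μ (n + 1)) g v) =
      restrictRep F (spechtRep F μ (n + 1)) g (f v)) :
    ∃ p : Polynomial F, f = Polynomial.aeval (jucysMurphy F μ (Fin.last n)) p := by
  apply exists_eq_aeval_jucysMurphy h2 hμ
  intro σ hσ v
  obtain ⟨τ, rfl⟩ := exists_symEmb_eq hσ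
  exact hf τ v

theorem blockPart_restrictRep (h2 : (2 : F) ≠ 0) (hμ : μ.card = n + 1)
    {b : MonoidAlgebra F (Perm (Fin n))} (hb : IsBlockIdempotent b) :
    blockPart b hb.mem_center (restrictRep F (spechtRep F μ (n + 1))).asModule = ⊥ ∨
      IsIndecomposableModule (MonoidAlgebra F (Perm (Fin n)))
        (blockPart b hb.mem_center (restrictRep F (spechtRep F μ (n + 1))).asModule) := by
  apply blockPart_asModule_eq_bot_or_indecomposable _ hb
  intro f hf
  obtain ⟨p, hp⟩ := exists_eq_aeval_of_commute_restrictRep h2 hμ f hf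
  obtain ⟨w, hw, hwL⟩ := exists_central_eq_jucysMurphy h2 μ n
  refine ⟨Polynomial.aeval w p, mem_center_of_commute_single fun g => commute_aeval (hw g) p, ?_⟩
  rw [hp, ← hwL, Polynomial.aeval_algHom_apply]

end Blocks

/-! ### Coset components of an induced module. -/

section InducedModules

section Induction

variable {F G H V : Type*} [Field F] [Group G] [Group H] [AddCommGroup V] [Module F V]
  (φ : G →* H) (ρ : Representation F G V)

theorem indV_mk_map_mul (g : G) (h : H) (v : V) :
    Representation.IndV.mk φ ρ (φ g * h) (ρ g v) = Representation.IndV.mk φ ρ h v := by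
  have key := Representation.Coinvariants.mk_self_apply
    (Representation.tprod ((Representation.leftRegular F H).comp φ) ρ) g
    (TensorProduct.tmul F (MonoidAlgebra.single h 1) v)
  rw [Representation.tprod_apply, TensorProduct.map_tmul] at key
  have h1 : ((Representation.leftRegular F H).comp φ) g (MonoidAlgebra.single h (1 : F)) =
      MonoidAlgebra.single (φ g * h) 1 := by simp
  rw [h1] at key
  exact key

open scoped Classical in
/-- The coefficient of the projection of an induced module to the component of the identity. -/
def indProjFun (h : H) : V →ₗ[F] V :=
  if hh : ∃ g, φ g = h then ρ hh.choose⁻¹ else 0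

variable {φ} in
theorem indProjFun_map (hφ : Function.Injective φ) (g : G) :
    indProjFun φ ρ (φ g) = ρ g⁻¹ := by
  have hh : ∃ g', φ g' = φ g := ⟨g, rfl⟩
  rw [indProjFun, dif_pos hh, hφ hh.choose_spec]

theorem indProjFun_of_notMem {h : H} (hh : ¬ ∃ g, φ g = h) : indProjFun φ ρ h = 0 := by
  rw [indProjFun, dif_neg hh]

variable {φ} in
/-- The projection of an induced module to the component of the identity. -/
def indProj (hφ : Function.Injective φ) : Representation.IndV φ ρ →ₗ[F] V :=
  Representation.Coinvariants.lift _
    (TensorProduct.lift ((Finsupp.lift (V →ₗ[F] V) F H (indProjFun φ ρ)) ∘ₗ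
      (MonoidAlgebra.coeffLinearEquiv F).toLinearMap)) (by
    intro g
    apply TensorProduct.ext
    apply MonoidAlgebra.lhom_ext'
    intro h
    ext v
    have h3 : indProjFun φ ρ (φ g * h) (ρ g v) = indProjFun φ ρ h v := by
      by_cases hh : ∃ g', φ g' = h
      · obtain ⟨g', rfl⟩ := hh
        rw [← map_mul, indProjFun_map ρ hφ, indProjFun_map ρ hφ, mul_inv_rev, map_mul,
          Module.End.mul_apply, Representation.inv_self_apply]
      · rw [indProjFun_of_notMem φ ρ hh, indProjFun_of_notMem φ ρ]
        · rfl
        · rintro ⟨g', hg'⟩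
          exact hh ⟨g⁻¹ * g', by rw [map_mul, hg', map_inv]; group⟩
    simpa using h3)

variable {φ} (hφ : Function.Injective φ)

theorem indProj_mk (h : H) (v : V) :
    indProj ρ hφ (Representation.IndV.mk φ ρ h v) = indProjFun φ ρ h v := by
  unfold indProj
  simp

theorem indProj_mk_one (v : V) :
    indProj ρ hφ (Representation.IndV.mk φ ρ 1 v) = v := by
  rw [indProj_mk, ← map_one φ, indProjFun_map ρ hφ, inv_one, map_one]
  rfl

theorem indProj_ind (g : G) (w : Representation.IndV φ ρ) :
    indProj ρ hφ (Representation.ind φ ρ (φ g) w) = ρ g (indProj ρ hφ w) := by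
  have h : indProj ρ hφ ∘ₗ Representation.ind φ ρ (φ g) = ρ g ∘ₗ indProj ρ hφ := by
    apply Representation.IndV.hom_ext
    intro h
    ext v
    simp only [LinearMap.comp_apply]
    have h1 := Representation.ind_mk φ ρ (φ g) h v
    simp only [LinearMap.comp_apply] at h1
    rw [h1]
    have h3 := indProj_mk ρ hφ (h * (φ g)⁻¹) v
    have h4 := indProj_mk ρ hφ h v
    simp only [LinearMap.comp_apply] at h3 h4
    rw [h3, h4]
    by_cases hh : ∃ g', φ g' = h
    · obtain ⟨g', rfl⟩ := hh
      rw [← map_inv, ← map_mul, indProjFun_map ρ hφ, indProjFun_map ρ hφ, mul_inv_rev, inv_inv,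
        map_mul]
      rfl
    · rw [indProjFun_of_notMem φ ρ hh, indProjFun_of_notMem φ ρ]
      · simp
      · rintro ⟨g', hg'⟩
        exact hh ⟨g' * g, by rw [map_mul, hg']; group⟩
  exact LinearMap.congr_fun h w

theorem ind_map_mk_one (g : G) (v : V) :
    Representation.ind φ ρ (φ g) (Representation.IndV.mk φ ρ 1 v) =
      Representation.IndV.mk φ ρ 1 (ρ g v) := by
  rw [Representation.ind_mk, ← indV_mk_map_mul φ ρ g]
  simp

theorem mk_eq_ind_mk_one (h : H) (v : V) :
    Representation.IndV.mk φ ρ h v =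
      Representation.ind φ ρ h⁻¹ (Representation.IndV.mk φ ρ 1 v) := by
  rw [Representation.ind_mk, inv_inv, one_mul]

theorem indV_hom_ext_of_commute {f f' : Representation.IndV φ ρ →ₗ[F] Representation.IndV φ ρ}
    (hf : ∀ h w, f (Representation.ind φ ρ h w) = Representation.ind φ ρ h (f w))
    (hf' : ∀ h w, f' (Representation.ind φ ρ h w) = Representation.ind φ ρ h (f' w))
    (h : ∀ v, f (Representation.IndV.mk φ ρ 1 v) = f' (Representation.IndV.mk φ ρ 1 v)) :
    f = f' := by
  apply Representation.IndV.hom_ext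
  intro k
  ext v
  change f (Representation.IndV.mk φ ρ k v) = f' (Representation.IndV.mk φ ρ k v)
  rw [mk_eq_ind_mk_one, hf, hf', h]

end Induction

variable {n : ℕ} {F V : Type*} [Field F] [AddCommGroup V] [Module F V]
  (ρ : Representation F (Perm (Fin n)) V)

theorem symEmb_injective : Function.Injective (symEmb n) :=
  Perm.viaEmbeddingHom_injective Fin.castSuccEmb

/-- An element of an induced module is the sum of its components on the cosets. -/
theorem induceRep_sum_components (w : Representation.IndV (symEmb n) ρ) :
    ∑ x, induceRep F ρ (swap (Fin.last n) x) (Representation.IndV.mk (symEmb n) ρ 1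
      (indProj ρ symEmb_injective (induceRep F ρ (swap (Fin.last n) x) w))) = w := by
  have h : ∑ x, induceRep F ρ (swap (Fin.last n) x) ∘ₗ Representation.IndV.mk (symEmb n) ρ 1 ∘ₗ
      indProj ρ symEmb_injective ∘ₗ induceRep F ρ (swap (Fin.last n) x) = LinearMap.id := by
    apply Representation.IndV.hom_ext
    intro h
    ext v
    have hmk : ∀ x, induceRep F ρ (swap (Fin.last n) x) (Representation.IndV.mk (symEmb n) ρ h v) =
        Representation.IndV.mk (symEmb n) ρ (h * swap (Fin.last n) x) v := fun x => by
      unfold induceRep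
      rw [Representation.ind_mk, swap_inv]
    have hgoal : ∑ x, induceRep F ρ (swap (Fin.last n) x) (Representation.IndV.mk (symEmb n) ρ 1
        (indProj ρ symEmb_injective (induceRep F ρ (swap (Fin.last n) x)
          (Representation.IndV.mk (symEmb n) ρ h v)))) =
          Representation.IndV.mk (symEmb n) ρ h v := by
      -- Only for this letter does `h * swap (Fin.last n) x` fix the last letter, that is, lie in
      -- the subgroup.
      rw [Finset.sum_eq_single (h⁻¹ (Fin.last n))]
      · rw [hmk, indProj_mk]
        obtain ⟨g, hg⟩ := exists_symEmb_eq (σ := h * swap (Fin.last n) (h⁻¹ (Fin.last n)))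
          (by rw [Perm.mul_apply, swap_apply_left]; exact h.apply_symm_apply _)
        rw [← hg, indProjFun_map ρ symEmb_injective, ← indV_mk_map_mul _ _ g,
          Representation.self_inv_apply, mul_one, hg]
        unfold induceRep
        rw [Representation.ind_mk, swap_inv, mul_assoc, swap_mul_self, mul_one]
      · intro x _ hx
        rw [hmk, indProj_mk, indProjFun_of_notMem]
        · simp
        · rintro ⟨g, hg⟩
          apply hx
          have h1 := symEmb_last g
          rw [hg, Perm.mul_apply, swap_apply_left] at h1
          rw [← h1]
          simp
      · simp
    rw [LinearMap.comp_apply, LinearMap.sum_apply]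
    exact hgoal
  have h3 := LinearMap.congr_fun h w
  rw [LinearMap.sum_apply] at h3
  exact h3

theorem induceRep_ext {w w' : Representation.IndV (symEmb n) ρ}
    (h : ∀ x, indProj ρ symEmb_injective (induceRep F ρ (swap (Fin.last n) x) w) =
      indProj ρ symEmb_injective (induceRep F ρ (swap (Fin.last n) x) w')) : w = w' := by
  rw [← induceRep_sum_components ρ w, ← induceRep_sum_components ρ w']
  exact Finset.sum_congr rfl fun x _ => by rw [h x]

end InducedModules

/-! ### Endomorphisms of the induced Specht module. -/

section InducedSpecht

variable {μ : YoungDiagram} {n : ℕ} {F : Type*} [Field F]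

section Components

variable {V : Type*} [AddCommGroup V] [Module F V] (ρ : Representation F (Perm (Fin (n + 1))) V)

/-- The component at the identity coset of an endomorphism of an induced module. -/
def identityComponent (f : Module.End F (Representation.IndV (symEmb (n + 1)) ρ)) : V →ₗ[F] V :=
  indProj ρ symEmb_injective ∘ₗ f ∘ₗ Representation.IndV.mk (symEmb (n + 1)) ρ 1

/-- The component at the coset of the last simple transposition of an endomorphism of an induced
module. -/
def swapComponent (f : Module.End F (Representation.IndV (symEmb (n + 1)) ρ)) : V →ₗ[F] V :=
  indProj ρ symEmb_injective ∘ₗ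
    induceRep F ρ (swap (Fin.last (n + 1)) (Fin.last n).castSucc) ∘ₗ f ∘ₗ
      Representation.IndV.mk (symEmb (n + 1)) ρ 1

theorem identityComponent_apply (f : Module.End F (Representation.IndV (symEmb (n + 1)) ρ))
    (v : V) : identityComponent ρ f v =
      indProj ρ symEmb_injective (f (Representation.IndV.mk (symEmb (n + 1)) ρ 1 v)) := rfl

theorem swapComponent_apply (f : Module.End F (Representation.IndV (symEmb (n + 1)) ρ)) (v : V) :
    swapComponent ρ f v = indProj ρ symEmb_injective
      (induceRep F ρ (swap (Fin.last (n + 1)) (Fin.last n).castSucc)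
        (f (Representation.IndV.mk (symEmb (n + 1)) ρ 1 v))) := rfl

theorem indProj_induceRep (g : Perm (Fin (n + 1))) (w : Representation.IndV (symEmb (n + 1)) ρ) :
    indProj ρ symEmb_injective (induceRep F ρ (symEmb (n + 1) g) w) =
      ρ g (indProj ρ symEmb_injective w) :=
  indProj_ind ρ symEmb_injective g w

theorem induceRep_mk_one (g : Perm (Fin (n + 1))) (v : V) :
    induceRep F ρ (symEmb (n + 1) g) (Representation.IndV.mk (symEmb (n + 1)) ρ 1 v) =
      Representation.IndV.mk (symEmb (n + 1)) ρ 1 (ρ g v) :=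
  ind_map_mk_one ρ g v

theorem induceRep_mul_apply (g h : Perm (Fin (n + 2)))
    (w : Representation.IndV (symEmb (n + 1)) ρ) :
    induceRep F ρ (g * h) w = induceRep F ρ g (induceRep F ρ h w) := by
  rw [map_mul]; rfl

variable {ρ} {f : Module.End F (Representation.IndV (symEmb (n + 1)) ρ)}

theorem identityComponent_rep (hf : ∀ g, Commute f (induceRep F ρ g)) (g : Perm (Fin (n + 1)))
    (v : V) : identityComponent ρ f (ρ g v) = ρ g (identityComponent ρ f v) := by
  have h := LinearMap.congr_fun (hf (symEmb (n + 1) g))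
    (Representation.IndV.mk (symEmb (n + 1)) ρ 1 v)
  rw [Module.End.mul_apply, Module.End.mul_apply] at h
  rw [identityComponent_apply, ← induceRep_mk_one, h, indProj_induceRep, identityComponent_apply]

theorem swap_last_conj (g : Perm (Fin (n + 1))) (x : Fin (n + 1)) :
    swap (Fin.last (n + 1)) (g x).castSucc =
      symEmb (n + 1) g * swap (Fin.last (n + 1)) x.castSucc * symEmb (n + 1) g⁻¹ := by
  rw [map_inv, ← swap_apply_apply, symEmb_last, symEmb_castSucc]

/-- The subgroup permutes the nontrivial cosets transitively, so one of their components determines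
all the others by conjugation. -/
theorem indProj_swap_conj (hf : ∀ g, Commute f (induceRep F ρ g)) (g : Perm (Fin (n + 1))) (v : V) :
    indProj ρ symEmb_injective (induceRep F ρ
      (swap (Fin.last (n + 1)) (g (Fin.last n)).castSucc)
        (f (Representation.IndV.mk (symEmb (n + 1)) ρ 1 v))) =
      ρ g (swapComponent ρ f (ρ g⁻¹ v)) := by
  have h := LinearMap.congr_fun (hf (symEmb (n + 1) g⁻¹))
    (Representation.IndV.mk (symEmb (n + 1)) ρ 1 v)
  rw [Module.End.mul_apply, Module.End.mul_apply] at h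
  rw [swap_last_conj, induceRep_mul_apply, induceRep_mul_apply, indProj_induceRep, ← h,
    induceRep_mk_one, swapComponent_apply]

theorem swapComponent_restrictRep (hf : ∀ g, Commute f (induceRep F ρ g)) (g : Perm (Fin n))
    (v : V) :
    swapComponent ρ f (restrictRep F ρ g v) = restrictRep F ρ g (swapComponent ρ f v) := by
  have h := indProj_swap_conj hf (symEmb n g) (ρ (symEmb n g) v)
  rw [symEmb_last, Representation.inv_self_apply] at h
  exact h

/-- This is Mackey's description for two double cosets: the identity component covers one and
`swapComponent` the other. -/
theorem eq_of_components_eq {f' : Module.End F (Representation.IndV (symEmb (n + 1)) ρ)}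
    (hf : ∀ g, Commute f (induceRep F ρ g)) (hf' : ∀ g, Commute f' (induceRep F ρ g))
    (h1 : identityComponent ρ f = identityComponent ρ f')
    (h3 : swapComponent ρ f = swapComponent ρ f') : f = f' := by
  apply indV_hom_ext_of_commute ρ (fun g w => LinearMap.congr_fun (hf g) w)
    (fun g w => LinearMap.congr_fun (hf' g) w)
  intro v
  apply induceRep_ext
  intro x
  induction x using Fin.lastCases with
  | last =>
    have hone : ∀ w, induceRep F ρ (Equiv.refl _) w = w := fun w => by
      change induceRep F ρ 1 w = w
      rw [map_one]; rfl
    rw [swap_self, hone, hone]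
    exact LinearMap.congr_fun h1 v
  | cast x =>
    have hx : x = swap (Fin.last n) x (Fin.last n) := by rw [swap_apply_left]
    rw [hx, indProj_swap_conj hf, indProj_swap_conj hf', h3]

theorem identityComponent_one : identityComponent ρ 1 = LinearMap.id := by
  ext v
  exact indProj_mk_one ρ symEmb_injective v

theorem swapComponent_one : swapComponent ρ 1 = 0 := by
  ext v
  rw [swapComponent_apply, Module.End.one_apply]
  unfold induceRep
  rw [Representation.ind_mk, indProj_mk, indProjFun_of_notMem]
  rintro ⟨g, hg⟩
  have h := symEmb_last g
  rw [hg, one_mul, swap_inv, swap_apply_left] at h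
  exact (Fin.castSucc_lt_last _).ne h

theorem identityComponent_add (f f' : Module.End F (Representation.IndV (symEmb (n + 1)) ρ)) :
    identityComponent ρ (f + f') = identityComponent ρ f + identityComponent ρ f' := by
  ext v; simp [identityComponent]

theorem identityComponent_smul (a : F)
    (f : Module.End F (Representation.IndV (symEmb (n + 1)) ρ)) :
    identityComponent ρ (a • f) = a • identityComponent ρ f := by
  ext v; simp [identityComponent]

theorem swapComponent_add (f f' : Module.End F (Representation.IndV (symEmb (n + 1)) ρ)) :
    swapComponent ρ (f + f') = swapComponent ρ f + swapComponent ρ f' := by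
  ext v; simp [swapComponent]

theorem swapComponent_smul (a : F)
    (f : Module.End F (Representation.IndV (symEmb (n + 1)) ρ)) :
    swapComponent ρ (a • f) = a • swapComponent ρ f := by
  ext v; simp [swapComponent]

/-- The class sum commutes with the chosen transposition and splits as the smaller sum, twice the
transpositions of the last letter, and the identity. The chosen transposition cancels itself and
yields the identity component; the others can be moved past `f` to act on `v`. -/
theorem swapComponent_swapSum_mul (hf : ∀ g, Commute f (induceRep F ρ g)) (v : V) :
    swapComponent ρ ((induceRep F ρ).asAlgebraHom (swapSum F (n + 2)) * f) v =
      ρ.asAlgebraHom (swapSum F (n + 1)) (swapComponent ρ f v) +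
        (2 : F) • (∑ x : Fin n, swapComponent ρ f (ρ (swap (Fin.last n) x.castSucc) v) +
          identityComponent ρ f v) + swapComponent ρ f v := by
  have hcomm := LinearMap.congr_fun (asAlgebraHom_swapSum_commute (induceRep F ρ)
    (swap (Fin.last (n + 1)) (Fin.last n).castSucc))
    (f (Representation.IndV.mk (symEmb (n + 1)) ρ 1 v))
  rw [Module.End.mul_apply, Module.End.mul_apply] at hcomm
  rw [swapComponent_apply, Module.End.mul_apply, ← hcomm, asAlgebraHom_swapSum_succ, map_add,
    map_add, map_smul, map_sum, ← swapComponent_apply]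
  congr 2
  · rw [asAlgebraHom_swapSum, asAlgebraHom_swapSum, map_sum]
    refine Finset.sum_congr rfl fun x _ => ?_
    rw [map_sum]
    exact Finset.sum_congr rfl fun y _ => indProj_induceRep ρ _ _
  · rw [Fin.sum_univ_castSucc]
    congr 2
    · refine Finset.sum_congr rfl fun x _ => ?_
      have hne : x.castSucc ≠ Fin.last n := (Fin.castSucc_lt_last x).ne
      have h := LinearMap.congr_fun (hf (symEmb (n + 1) (swap (Fin.last n) x.castSucc)))
        (Representation.IndV.mk (symEmb (n + 1)) ρ 1 v)
      rw [Module.End.mul_apply, Module.End.mul_apply, induceRep_mk_one, symEmb_swap] at h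
      rw [← induceRep_mul_apply, swap_mul_swap_eq (Fin.castSucc_lt_last _).ne
        (fun h => hne (Fin.castSucc_injective _ h)), induceRep_mul_apply, ← h]
      rfl
    · rw [← induceRep_mul_apply, swap_mul_self, map_one]
      rfl

end Components

/-- Multiplying `P` by X multiplies `s P` by `2L` up to terms already reached, and `s X` is an
invertible scalar. -/
theorem exists_eq_aeval_of_recurrence {A : Type*} [Ring A] [Algebra F A] {L : A} (h2 : (2 : F) ≠ 0)
    (s : Polynomial F →ₗ[F] A) (a : F) (hX : s Polynomial.X = (2 : F) • (1 : A))
    (hrec : ∀ P : Polynomial F, ∃ d : F,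
      s (Polynomial.X * P) = a • s P + (2 : F) • (s P * L + d • (1 : A)) + s P)
    (p : Polynomial F) : ∃ P : Polynomial F, s P = Polynomial.aeval L p := by
  induction p using Polynomial.induction_on with
  | C c =>
    refine ⟨(c / 2) • Polynomial.X, ?_⟩
    rw [map_smul, hX, smul_smul, div_mul_cancel₀ _ h2, Polynomial.aeval_C,
      Algebra.algebraMap_eq_smul_one]
  | add p q hp hq =>
    obtain ⟨P, hP⟩ := hp
    obtain ⟨Q, hQ⟩ := hq
    exact ⟨P + Q, by rw [map_add, map_add, hP, hQ]⟩
  | monomial k c ih =>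
    obtain ⟨P, hP⟩ := ih
    obtain ⟨d, hd⟩ := hrec P
    -- The recurrence is solved for `s P * L`; the scalar `d` is removed using that `s` sends X to
    -- 2.
    refine ⟨(1 / 2 : F) • (Polynomial.X * P) - ((a + 1) / 2) • P - (d / 2) • Polynomial.X, ?_⟩
    rw [map_sub, map_sub, map_smul, map_smul, map_smul, hd, hX, hP, pow_succ, ← mul_assoc,
      Polynomial.aeval_mul (q := Polynomial.X), Polynomial.aeval_X]
    match_scalars <;> field_simp
    all_goals ring

theorem exists_eq_aeval_swapSum_of_commute_ind {V : Type*} [AddCommGroup V] [Module F V]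
    {ρ : Representation F (Perm (Fin (n + 1))) V} (h2 : (2 : F) ≠ 0) {a : F}
    (ha : ∀ v, ρ.asAlgebraHom (swapSum F (n + 1)) v = a • v) {L : Module.End F V}
    (hL : ∀ v, L v = ∑ x : Fin n, ρ (swap (Fin.last n) x.castSucc) v)
    (hscalar : ∀ f : V →ₗ[F] V, (∀ g v, f (ρ g v) = ρ g (f v)) → ∃ c : F, ∀ v, f v = c • v)
    (hrestrict : ∀ f : V →ₗ[F] V,
      (∀ g v, f (restrictRep F ρ g v) = restrictRep F ρ g (f v)) →
        ∃ p : Polynomial F, f = Polynomial.aeval L p)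
    {f : Module.End F (Representation.IndV (symEmb (n + 1)) ρ)}
    (hf : ∀ g, Commute f (induceRep F ρ g)) :
    ∃ p : Polynomial F,
      f = Polynomial.aeval ((induceRep F ρ).asAlgebraHom (swapSum F (n + 2))) p := by
  set Y := (induceRep F ρ).asAlgebraHom (swapSum F (n + 2)) with hY
  have hcomm : ∀ (p : Polynomial F) g, Commute (Polynomial.aeval Y p) (induceRep F ρ g) :=
    fun p g => commute_aeval (asAlgebraHom_swapSum_commute _ g) p
  have hident : ∀ {f : Module.End F (Representation.IndV (symEmb (n + 1)) ρ)},
      (∀ g, Commute f (induceRep F ρ g)) →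
        ∃ c : F, identityComponent ρ f = c • LinearMap.id := by
    intro f hf
    obtain ⟨c, hc⟩ := hscalar (identityComponent ρ f) (identityComponent_rep hf)
    exact ⟨c, LinearMap.ext hc⟩
  have hrec : ∀ P : Polynomial F, swapComponent ρ (Polynomial.aeval Y (Polynomial.X * P)) =
      a • swapComponent ρ (Polynomial.aeval Y P) +
        (2 : F) • (swapComponent ρ (Polynomial.aeval Y P) ∘ₗ L +
          identityComponent ρ (Polynomial.aeval Y P)) +
        swapComponent ρ (Polynomial.aeval Y P) := by
    intro P
    ext v : 1
    rw [map_mul, Polynomial.aeval_X, swapComponent_swapSum_mul (hcomm P), ha]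
    simp only [LinearMap.add_apply, LinearMap.smul_apply, LinearMap.comp_apply, hL, map_sum]
  have hX : swapComponent ρ (Polynomial.aeval Y (Polynomial.X : Polynomial F)) =
      (2 : F) • LinearMap.id := by
    have h := hrec 1
    rw [mul_one, map_one, swapComponent_one, identityComponent_one] at h
    rw [h, LinearMap.zero_comp, smul_zero, zero_add, zero_add, add_zero]
  let s : Polynomial F →ₗ[F] Module.End F V :=
    { toFun := fun P => swapComponent ρ (Polynomial.aeval Y P)
      map_add' := fun P Q => by rw [map_add, swapComponent_add]
      map_smul' := fun c P => by rw [map_smul, swapComponent_smul]; rfl }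
  obtain ⟨p, hp⟩ := hrestrict (swapComponent ρ f) (swapComponent_restrictRep hf)
  obtain ⟨P, hP⟩ := exists_eq_aeval_of_recurrence (L := L) h2 s a hX (fun P => by
    obtain ⟨d, hd⟩ := hident (hcomm P)
    refine ⟨d, (hrec P).trans ?_⟩
    rw [hd]
    rfl) p
  obtain ⟨c, hc⟩ := hident hf
  obtain ⟨d, hd⟩ := hident (hcomm P)
  -- `P` already gives the right swap component. A constant has swap component zero, so it corrects
  -- the identity component freely.
  refine ⟨P + Polynomial.C (c - d), eq_of_components_eq hf (hcomm _) ?_ ?_⟩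
  · rw [map_add, Polynomial.aeval_C, Algebra.algebraMap_eq_smul_one, identityComponent_add,
      identityComponent_smul, identityComponent_one, hc, hd]
    module
  · rw [map_add, Polynomial.aeval_C, Algebra.algebraMap_eq_smul_one, swapComponent_add,
      swapComponent_smul, swapComponent_one, hp, ← hP, smul_zero, add_zero]
    rfl

/-- Every endomorphism of an induced Specht module is a polynomial in the sum of the
transpositions, in characteristic not two. -/
theorem exists_eq_aeval_swapSum_of_commute_induceRep (h2 : (2 : F) ≠ 0) (hμ : μ.card = n + 1)
    {f : Module.End F (Representation.IndV (symEmb (n + 1)) (spechtRep F μ (n + 1)))}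
    (hf : ∀ g, Commute f (induceRep F (spechtRep F μ (n + 1)) g)) :
    ∃ p : Polynomial F, f = Polynomial.aeval
      ((induceRep F (spechtRep F μ (n + 1))).asAlgebraHom (swapSum F (n + 2))) p := by
  obtain ⟨a, ha⟩ := exists_asAlgebraHom_swapSum_eq_smul h2 μ (n + 1)
  exact exists_eq_aeval_swapSum_of_commute_ind h2 ha (fun v => jucysMurphy_last_apply v)
    (fun f hf => exists_eq_smul_of_commute h2 f hf)
    (fun f hf => exists_eq_aeval_of_commute_restrictRep h2 hμ f hf) hf

theorem blockPart_induceRep (h2 : (2 : F) ≠ 0) (hμ : μ.card = n + 1)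
    {B : MonoidAlgebra F (Perm (Fin (n + 2)))} (hB : IsBlockIdempotent B) :
    blockPart B hB.mem_center (induceRep F (spechtRep F μ (n + 1))).asModule = ⊥ ∨
      IsIndecomposableModule (MonoidAlgebra F (Perm (Fin (n + 2))))
        (blockPart B hB.mem_center (induceRep F (spechtRep F μ (n + 1))).asModule) := by
  apply blockPart_asModule_eq_bot_or_indecomposable _ hB
  intro f hf
  obtain ⟨p, hp⟩ := exists_eq_aeval_swapSum_of_commute_induceRep h2 hμ
    (f := f) fun g => LinearMap.ext (hf g)
  refine ⟨Polynomial.aeval (swapSum F (n + 2)) p,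
    mem_center_of_commute_single fun g => commute_aeval (commute_swapSum g) p, ?_⟩
  rw [hp, Polynomial.aeval_algHom_apply]

end InducedSpecht

end SpechtModules

end

-- The partition has size `n + 1`, so positivity of its size is built in, and the neighbouring
-- groups act on `n` and `n + 2` letters.
open SpechtModules in
theorem theorem3p4 (F : Type*) [Field F] (hF : ringChar F ≠ 2)
    (n : ℕ) (μ : YoungDiagram) (hμ : μ.card = n + 1) :
    (∀ (b : MonoidAlgebra F (Equiv.Perm (Fin n))) (hb : IsBlockIdempotent b),
      blockPart b hb.mem_center (restrictRep F (spechtRep F μ (n + 1))).asModule = ⊥ ∨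
      IsIndecomposableModule (MonoidAlgebra F (Equiv.Perm (Fin n)))
        (blockPart b hb.mem_center (restrictRep F (spechtRep F μ (n + 1))).asModule)) ∧
    (∀ (B : MonoidAlgebra F (Equiv.Perm (Fin (n + 2)))) (hB : IsBlockIdempotent B),
      blockPart B hB.mem_center (induceRep F (spechtRep F μ (n + 1))).asModule = ⊥ ∨
      IsIndecomposableModule (MonoidAlgebra F (Equiv.Perm (Fin (n + 2))))
        (blockPart B hB.mem_center (induceRep F (spechtRep F μ (n + 1))).asModule)) := by
  have h2 : (2 : F) ≠ 0 := Ring.two_ne_zero hF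
  exact ⟨fun b hb => blockPart_restrictRep h2 hμ hb, fun B hB => blockPart_induceRep h2 hμ hB⟩
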